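/- Let $n,p\ge 1$ be integers and let $u_0$ be a holomorphic function in a neighbourhood of $0\in\mathbb{C}^n$. Consider, for complex variables $(t,x)=(t,x_1,\dots,x_n)\in\mathbb{C}\times\mathbb{C}^n$, the ramified Cauchy problem $$u_t-u\,(u_{x_1}+\dots+u_{x_n})=0,\qquad u(0,x)=u_0(x)+x_1^{1/p}.\qquad(*)$$ Then there exist an open neighbourhood $U$ of $0\in\mathbb{C}^{n+1}$ and holomorphic functions $v,a_0,\dots,a_{p-1}$ on $U$ with $$v(0,x)=u_0(x),\qquad a_0(0,x)=x_1,\qquad a_j(0,x)=0\quad(1\le j\le p-1)$$ for all $x$ with $(0,x)\in U$, such that $u=v+z$ is the unique solution of $(*)$, where the (multivalued) function $z$ is defined by $$z^p=a_{p-1}(t,x)\,z^{p-1}+\dots+a_1(t,x)\,z+a_0(t,x).\qquad(**)$$ Precisely, let $\Sigma\subset U$ be the set of points at which $(**)$ has a multiple root in $z$. Then: 1. $\Sigma$ is the zero set of a holomorphic function on $U$; a point $(0,x)\in U$ lies in $\Sigma$ if and only if $p\ge 2$ and $x_1=0$; and $\Sigma$ is characteristic for the equation, i.e. if $q\in\Sigma$,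 $\zeta$ is a multiple root of $(**)$ at $q$, and $h$ is a holomorphic germ at $q$ vanishing on $\Sigma$, then $h_t(q)=(v(q)+\zeta)\,(h_{x_1}(q)+\dots+h_{x_n}(q))$. 2. For every $q\in U\setminus\Sigma$ and every holomorphic germ $z$ at $q$ satisfying $(**)$, the germ $v+z$ satisfies $u_t=u\,(u_{x_1}+\dots+u_{x_n})$. 3. For every point $(0,x^0)\in U\setminus\Sigma$ and every holomorphic germ $r$ at $x^0$ with $r(x)^p=x_1$ (a branch of $x_1^{1/p}$), there is a holomorphic germ $z$ at $(0,x^0)$ satisfying $(**)$ and $z(0,x)=r(x)$ such that $u=v+z$ solves $(*)$ near $(0,x^0)$ with $x_1^{1/p}$ read as $r(x)$; every holomorphic germ at $(0,x^0)$ that solves this problem coincides with $u$; and $u$ can be continued holomorphically along every path in $U\setminus\Sigma$ starting at $(0,x^0)$. -/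

import Mathlib

open Filter Topology

namespace RamifiedBurgers

/-- The complex space-time `ℂ × ℂⁿ` with points `(t, x)`; the coordinate `x₁` is `x 0`. -/
abbrev SpaceTime (n : ℕ) : Type := ℂ × (Fin n → ℂ)

/-- The transport operator with speed `c` at the point `q`: `h_t - c (h_{x₁} + ⋯ + h_{xₙ})`. -/
noncomputable def transport {n : ℕ} (c : ℂ) (h : SpaceTime n → ℂ) (q : SpaceTime n) : ℂ :=
  fderiv ℂ h q (1, 0) - c * ∑ i : Fin n, fderiv ℂ h q (0, Pi.single i 1)

/-- The value at `q` of `u_t - u (u_{x₁} + ⋯ + u_{xₙ})`. -/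
noncomputable def burgers {n : ℕ} (u : SpaceTime n → ℂ) (q : SpaceTime n) : ℂ :=
  transport (u q) u q

/-- `r` is (a representative of) a holomorphic branch of `x₁ ^ (1/p)` at the point `x₀`. -/
def IsRootBranch {n : ℕ} [NeZero n] (p : ℕ) (r : (Fin n → ℂ) → ℂ) (x₀ : Fin n → ℂ) : Prop :=
  AnalyticAt ℂ r x₀ ∧ ∀ᶠ x in 𝓝 x₀, r x ^ p = x 0

/-- `u` is (a representative of) a holomorphic germ at `(0, x₀)` that solves
`u_t - u (u_{x₁} + ⋯ + u_{xₙ}) = 0`, `u(0, x) = u₀(x) + r(x)`. -/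
def IsSolutionGerm {n : ℕ} (u₀ r : (Fin n → ℂ) → ℂ) (x₀ : Fin n → ℂ)
    (u : SpaceTime n → ℂ) : Prop :=
  AnalyticAt ℂ u (0, x₀) ∧
    (∀ᶠ q in 𝓝 ((0, x₀) : SpaceTime n), burgers u q = 0) ∧
    ∀ᶠ x in 𝓝 x₀, u (0, x) = u₀ x + r x

/-- `ζ` is a root of the algebraic equation
`z ^ p = a_{p-1}(q) z ^ (p-1) + ⋯ + a_1(q) z + a_0(q)`. -/
def IsRootAt {n p : ℕ} (a : Fin p → SpaceTime n → ℂ) (q : SpaceTime n) (ζ : ℂ) : Prop :=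
  ζ ^ p = ∑ j : Fin p, a j q * ζ ^ (j : ℕ)

/-- `ζ` is a multiple root of the same equation: the `z`-derivative vanishes there as well. -/
def IsMultipleRootAt {n p : ℕ} (a : Fin p → SpaceTime n → ℂ) (q : SpaceTime n) (ζ : ℂ) : Prop :=
  IsRootAt a q ζ ∧
    (p : ℂ) * ζ ^ (p - 1) = ∑ j : Fin p, a j q * (((j : ℕ) : ℂ) * ζ ^ ((j : ℕ) - 1))

/-- `z` is (a representative of) a holomorphic germ at `q` that solves the algebraic equation. -/
def IsAlgebraicGerm {n p : ℕ} (a : Fin p → SpaceTime n → ℂ) (q : SpaceTime n)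
    (z : SpaceTime n → ℂ) : Prop :=
  AnalyticAt ℂ z q ∧ ∀ᶠ q' in 𝓝 q, IsRootAt a q' (z q')

/-- The germ of `f` at `γ 0` can be continued holomorphically along the path `γ`. -/
def ContinuesAlong {n : ℕ} (f : SpaceTime n → ℂ) (γ : C(unitInterval, SpaceTime n)) : Prop :=
  ∃ F : unitInterval → SpaceTime n → ℂ,
    F 0 =ᶠ[𝓝 (γ 0)] f ∧
    (∀ τ, AnalyticAt ℂ (F τ) (γ τ)) ∧
    ∀ τ, ∀ᶠ σ in 𝓝 τ, F σ =ᶠ[𝓝 (γ σ)] F τ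

/-- The set `S` is characteristic for the Burgers operator along `u = v + z`, where `z` is the
algebraic function with coefficients `a`: the symbol `τ - u (ξ₁ + ⋯ + ξₙ)` of the linearized
operator, with `u = v(q) + ζ` and `ζ` a value of `z` that branches at `q ∈ S`, vanishes on every
conormal `dh(q)`, `h` a holomorphic germ at `q` that vanishes on `S`. -/
def IsCharacteristic {n p : ℕ} (v : SpaceTime n → ℂ) (a : Fin p → SpaceTime n → ℂ)
    (S : Set (SpaceTime n)) : Prop :=
  ∀ q ∈ S, ∀ ζ : ℂ, IsMultipleRootAt a q ζ →
    ∀ h : SpaceTime n → ℂ, AnalyticAt ℂ h q → (∀ᶠ q' in 𝓝 q, q' ∈ S → h q' = 0) →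
      transport (v q + ζ) h q = 0

end RamifiedBurgers

/-! A solution of the Burgers equation is constant along the complex lines in the direction (1, -u,
..., -u). The line with speed c through (t, x) meets t = 0 at y = x + t c (1, ..., 1), so u = c must
satisfy (c - u₀(y))^p = y₁, which is `implicitEq`. Conversely, differentiating this equation along
the line shows that every simple zero c = u(t, x) solves the Burgers equation.

Put c = u₀(x) + z, so that v(t, x) = u₀(x). At the origin the equation becomes z^p = 0, and
`weierstrass_preparation` replaces it nearby by a monic polynomial of degree p in z, whose
coefficients are the a_j. At t = 0 the equation is already z^p - x₁, so uniqueness of the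
Weierstrass polynomial gives the initial values. `exists_polynomial_equation` collects this on a
neighbourhood so small that all roots lie where the factorization holds. The branch locus is the
zero set of the resultant of the polynomial and its derivative.

Existence and uniqueness of the germ follow from the implicit function theorem at a simple root,
since any solution germ satisfies the implicit equation (`eventually_eq_apply_foot`, a Grönwall
argument). Continuation is path lifting: the roots form a covering over the coefficients without
multiple root (`isCoveringMapOn_polyFamily`).

The branch locus is characteristic because it is an envelope: through each double zero runs a curve
of double zeros whose velocity is a multiple of the characteristic direction
(`exists_curve_of_double_zero`). A function vanishing on the locus is differentiated along this
curve. -/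

/-! ### Analytic composition operators and implicit functions -/

namespace FormalMultilinearSeries

variable {𝕜 : Type*} [NontriviallyNormedField 𝕜]
  {E : Type*} [NormedAddCommGroup E] [NormedSpace 𝕜 E]
  {F : Type*} [NormedAddCommGroup F] [NormedSpace 𝕜 F]

/-- The formal multilinear series of `f ↦ g ∘ f` on continuous functions on a compact space, where
`g` has the formal multilinear series `s`. -/
noncomputable def onContinuousMap (K : Type*) [TopologicalSpace K] [CompactSpace K]
    (s : FormalMultilinearSeries 𝕜 E F) : FormalMultilinearSeries 𝕜 C(K, E) C(K, F) := fun k =>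
  MultilinearMap.mkContinuous
    { toFun := fun f => ⟨fun θ => s k fun i => f i θ, by fun_prop⟩
      map_update_add' := by
        intro _ f i x y
        ext θ
        have h (z : C(K, E)) : (fun j => Function.update f i z j θ) =
            Function.update (fun j => f j θ) i (z θ) := by
          ext j; by_cases hj : j = i
          · subst hj; simp
          · simp [hj]
        simp only [ContinuousMap.coe_mk, ContinuousMap.add_apply, h]
        exact (s k).map_update_add _ _ _ _
      map_update_smul' := by
        intro _ f i c x
        ext θ
        have h (z : C(K, E)) : (fun j => Function.update f i z j θ) =
            Function.update (fun j => f j θ) i (z θ) := by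
          ext j; by_cases hj : j = i
          · subst hj; simp
          · simp [hj]
        simp only [ContinuousMap.coe_mk, ContinuousMap.smul_apply, h]
        exact (s k).map_update_smul _ _ _ _ }
    ‖s k‖ fun f => by
      rw [ContinuousMap.norm_le _ (by positivity)]
      intro θ
      refine ((s k).le_opNorm _).trans ?_
      gcongr with i
      exact (f i).norm_coe_le_norm θ

variable {K : Type*} [TopologicalSpace K] [CompactSpace K]

theorem radius_le_radius_onContinuousMap (s : FormalMultilinearSeries 𝕜 E F) :
    s.radius ≤ (s.onContinuousMap K).radius :=
  radius_le_of_le fun _ => MultilinearMap.mkContinuous_norm_le _ (norm_nonneg _) _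

end FormalMultilinearSeries

/-- Composition with an analytic function is analytic on continuous functions on a compact space. -/
theorem HasFPowerSeriesOnBall.exists_analyticAt_comp_continuousMap
    {𝕜 : Type*} [NontriviallyNormedField 𝕜]
    {E : Type*} [NormedAddCommGroup E] [NormedSpace 𝕜 E]
    {F : Type*} [NormedAddCommGroup F] [NormedSpace 𝕜 F] [CompleteSpace F]
    (K : Type*) [TopologicalSpace K] [CompactSpace K]
    {g : E → F} {s : FormalMultilinearSeries 𝕜 E F} {r : ENNReal}
    (hg : HasFPowerSeriesOnBall g s 0 r) :
    ∃ N : C(K, E) → C(K, F), (∀ f ∈ Metric.eball 0 r, AnalyticAt 𝕜 N f) ∧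
      ∀ f ∈ Metric.eball 0 r, ∀ θ, N f θ = g (f θ) := by
  have hr : r ≤ (s.onContinuousMap K).radius := hg.r_le.trans s.radius_le_radius_onContinuousMap
  have hN := (s.onContinuousMap K).hasFPowerSeriesOnBall (hg.r_pos.trans_le hr)
  refine ⟨(s.onContinuousMap K).sum,
    fun f hf => hN.analyticAt_of_mem (Metric.eball_subset_eball hr hf), fun f hf θ => ?_⟩
  -- Evaluation at θ is continuous and linear, so it carries the series in C(K, F) to the series of
  -- g at f θ.
  have h1 := (s.onContinuousMap K).hasSum (Metric.eball_subset_eball hr hf)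
  have h2 := (ContinuousMap.evalCLM 𝕜 θ : C(K, F) →L[𝕜] F).hasSum h1
  have hfθ : f θ ∈ Metric.eball (0 : E) r := by
    rw [Metric.mem_eball, edist_zero_right] at hf ⊢
    refine lt_of_le_of_lt ?_ hf
    rw [← ofReal_norm, ← ofReal_norm]
    exact ENNReal.ofReal_le_ofReal (f.norm_coe_le_norm θ)
  have h3 := hg.hasSum hfθ
  rw [zero_add] at h3
  exact h2.unique h3

/-- The analytic implicit function theorem on a product. -/
theorem AnalyticAt.exists_implicitFunction {𝕜 : Type*} [RCLike 𝕜]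
    {E : Type*} [NormedAddCommGroup E] [NormedSpace 𝕜 E] [CompleteSpace E]
    {F : Type*} [NormedAddCommGroup F] [NormedSpace 𝕜 F] [CompleteSpace F]
    {G : Type*} [NormedAddCommGroup G] [NormedSpace 𝕜 G] [CompleteSpace G]
    {f : E × F → G} {x₀ : E} {y₀ : F} (hf : AnalyticAt 𝕜 f (x₀, y₀)) (hf₀ : f (x₀, y₀) = 0)
    (hi : (fderiv 𝕜 f (x₀, y₀) ∘L .inr 𝕜 E F).IsInvertible) :
    ∃ g : E → F, AnalyticAt 𝕜 g x₀ ∧ g x₀ = y₀ ∧ (∀ᶠ x in 𝓝 x₀, f (x, g x) = 0) ∧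
      ∀ᶠ w in 𝓝 (x₀, y₀), f w = 0 → w.2 = g w.1 := by
  have hc : ContDiffAt 𝕜 ⊤ f (x₀, y₀) := hf.contDiffAt
  have hn : (⊤ : WithTop ℕ∞) ≠ 0 := by simp
  refine ⟨hc.implicitFunction hn hi, (hc.contDiffAt_implicitFunction hn hi).analyticAt,
    hc.implicitFunction_apply_self hn hi, ?_, ?_⟩
  · simpa [hf₀] using hc.eventually_apply_implicitFunction hn hi
  · filter_upwards [hc.eventually_apply_eq_iff_implicitFunction hn hi] with w hw h
    exact (hw.1 (by rw [h, hf₀])).symm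

/-! ### Monic polynomials, residues on a circle and Cauchy transforms -/

namespace RamifiedBurgers

open Polynomial in
/-- The monic polynomial `X ^ p - ∑ j, a j X ^ j`. -/
noncomputable def weierstrassPoly {p : ℕ} (a : Fin p → ℂ) : ℂ[X] :=
  X ^ p - ∑ j : Fin p, C (a j) * X ^ (j : ℕ)

section weierstrassPoly

open Polynomial

variable {p : ℕ} (a : Fin p → ℂ)

theorem eval_weierstrassPoly (z : ℂ) :
    (weierstrassPoly a).eval z = z ^ p - ∑ j : Fin p, a j * z ^ (j : ℕ) := by
  simp [weierstrassPoly, eval_finsetSum]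

theorem degree_sum_C_mul_X_pow_lt : (∑ j : Fin p, C (a j) * X ^ (j : ℕ)).degree < (p : WithBot ℕ) := by
  refine (degree_sum_le _ _).trans_lt ?_
  refine (Finset.sup_lt_iff (WithBot.bot_lt_coe p)).2 fun j _ => ?_
  exact (degree_C_mul_X_pow_le _ _).trans_lt (WithBot.coe_lt_coe.2 j.2)

theorem monic_weierstrassPoly : (weierstrassPoly a).Monic :=
  monic_X_pow_sub (degree_sum_C_mul_X_pow_lt a)

theorem natDegree_weierstrassPoly : (weierstrassPoly a).natDegree = p := by
  refine natDegree_eq_of_degree_eq_some ?_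
  rw [weierstrassPoly, degree_sub_eq_left_of_degree_lt, degree_X_pow]
  rw [degree_X_pow]
  exact degree_sum_C_mul_X_pow_lt a

end weierstrassPoly

section CircleMean

/-- The extension by zero of a function on a circle. -/
noncomputable def circleExt {ρ : ℝ} (f : C(Metric.sphere (0 : ℂ) ρ, ℂ)) (z : ℂ) : ℂ :=
  open Classical in if h : z ∈ Metric.sphere (0 : ℂ) ρ then f ⟨z, h⟩ else 0

variable {ρ : ℝ}

theorem circleExt_of_mem (f : C(Metric.sphere (0 : ℂ) ρ, ℂ)) {z : ℂ}
    (h : z ∈ Metric.sphere (0 : ℂ) ρ) : circleExt f z = f ⟨z, h⟩ := by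
  simp only [circleExt, dif_pos h]

theorem continuousOn_circleExt (f : C(Metric.sphere (0 : ℂ) ρ, ℂ)) :
    ContinuousOn (circleExt f) (Metric.sphere 0 ρ) := by
  rw [continuousOn_iff_continuous_domRestrict]
  convert f.continuous using 1
  ext z
  exact circleExt_of_mem f z.2

/-- The functional `f ↦ (2πi)⁻¹ ∮ f` on continuous functions on a circle. -/
noncomputable def circleResidue (hρ : 0 ≤ ρ) : C(Metric.sphere (0 : ℂ) ρ, ℂ) →L[ℂ] ℂ :=
  LinearMap.mkContinuous
    { toFun := fun f => (2 * (Real.pi : ℂ) * Complex.I)⁻¹ • ∮ z in C(0, ρ), circleExt f z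
      map_add' := fun f g => by
        rw [← smul_add, ← circleIntegral.integral_add
          ((continuousOn_circleExt f).circleIntegrable hρ)
          ((continuousOn_circleExt g).circleIntegrable hρ)]
        congr 1
        refine circleIntegral.integral_congr hρ fun z hz => ?_
        simp [circleExt_of_mem _ hz]
      map_smul' := fun c f => by
        rw [RingHom.id_apply, smul_comm, ← circleIntegral.integral_smul c (circleExt f)]
        congr 1
        refine circleIntegral.integral_congr hρ fun z hz => ?_
        simp [circleExt_of_mem _ hz] }
    ρ fun f => by
      refine circleIntegral.norm_two_pi_i_inv_smul_integral_le_of_norm_le_const hρ fun z hz => ?_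
      rw [circleExt_of_mem _ hz]
      exact f.norm_coe_le_norm _

theorem circleResidue_apply (hρ : 0 ≤ ρ) {f : C(Metric.sphere (0 : ℂ) ρ, ℂ)} {g : ℂ → ℂ}
    (h : ∀ z, f z = g z) :
    circleResidue hρ f = (2 * (Real.pi : ℂ) * Complex.I)⁻¹ * ∮ z in C(0, ρ), g z := by
  change (2 * (Real.pi : ℂ) * Complex.I)⁻¹ * (∮ z in C(0, ρ), circleExt f z) = _
  congr 1
  refine circleIntegral.integral_congr hρ fun z hz => ?_
  rw [circleExt_of_mem _ hz]
  exact h ⟨z, hz⟩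

theorem circleResidue_zpow (hρ : 0 < ρ) {f : C(Metric.sphere (0 : ℂ) ρ, ℂ)} (m : ℤ)
    (h : ∀ z, f z = (z : ℂ) ^ m) : circleResidue hρ.le f = if m = -1 then 1 else 0 := by
  rw [circleResidue_apply hρ.le (g := fun z => z ^ m) h]
  split_ifs with hm
  · have := circleIntegral.integral_sub_center_inv (0 : ℂ) hρ.ne'
    simp only [sub_zero] at this
    simp only [hm, zpow_neg_one, this]
    exact inv_mul_cancel₀ Complex.two_pi_I_ne_zero
  · have := circleIntegral.integral_sub_zpow_of_ne hm (0 : ℂ) 0 ρ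
    simp only [sub_zero] at this
    simp [this]

end CircleMean

/-- If the moments of order `< p` of `f / W` vanish on a circle, where `W` is monic of degree `p`,
then `W` divides `f` inside the circle, and the quotient is the Cauchy transform of `f / W`. -/
theorem eq_cauchyTransform_mul_of_moments_eq_zero {ρ : ℝ} (hρ : 0 < ρ) {p : ℕ} [NeZero p]
    (a : Fin p → ℂ) {f h : ℂ → ℂ} (hf : DifferentiableOn ℂ f (Metric.closedBall 0 ρ))
    (hh : ContinuousOn h (Metric.sphere 0 ρ))
    (hfh : ∀ z ∈ Metric.sphere (0 : ℂ) ρ, f z = h z * (weierstrassPoly a).eval z)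
    (hm : ∀ k < p, ∮ z in C(0, ρ), h z * z ^ k = 0) {w : ℂ} (hw : w ∈ Metric.ball 0 ρ) :
    f w = ((2 * (Real.pi : ℂ) * Complex.I)⁻¹ • ∮ z in C(0, ρ), (z - w)⁻¹ • h z) *
      (weierstrassPoly a).eval w := by
  set W := weierstrassPoly a
  set G := W /ₘ (Polynomial.X - Polynomial.C w)
  have hne : ∀ z ∈ Metric.sphere (0 : ℂ) ρ, z - w ≠ 0 := by
    intro z hz hzw
    rw [sub_eq_zero] at hzw
    subst hzw
    simp only [mem_sphere_iff_norm, Metric.mem_ball, dist_eq_norm] at hz hw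
    linarith
  have hG : ∀ z, W.eval z = W.eval w + (z - w) * G.eval z := by
    intro z
    conv_lhs => rw [← Polynomial.modByMonic_add_div W (Polynomial.X - Polynomial.C w),
      Polynomial.modByMonic_X_sub_C_eq_C_eval]
    simp [G]
  have hGd : G.natDegree < p := by
    have hp := NeZero.pos p
    rw [Polynomial.natDegree_divByMonic _ (Polynomial.monic_X_sub_C w),
      Polynomial.natDegree_X_sub_C, natDegree_weierstrassPoly]
    omega
  have hci : ∀ g : ℂ → ℂ, ContinuousOn g (Metric.sphere 0 ρ) → CircleIntegrable g 0 ρ :=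
    fun g hg => hg.circleIntegrable hρ.le
  have hGint : ∮ z in C(0, ρ), h z * G.eval z = 0 := by
    have : ∀ z, h z * G.eval z = ∑ k ∈ Finset.range p, G.coeff k * (h z * z ^ k) := by
      intro z
      rw [Polynomial.eval_eq_sum_range' hGd, Finset.mul_sum]
      refine Finset.sum_congr rfl fun k _ => by ring
    simp only [this]
    rw [circleIntegral.integral_fun_sum]
    · refine Finset.sum_eq_zero fun k hk => ?_
      rw [circleIntegral.integral_const_mul, hm k (Finset.mem_range.1 hk), mul_zero]
    · intro k _
      exact hci _ (by fun_prop)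
  have hC := hf.circleIntegral_sub_inv_smul hw
  have hsplit : ∮ z in C(0, ρ), (z - w)⁻¹ • f z =
      (∮ z in C(0, ρ), (z - w)⁻¹ • h z) * W.eval w := by
    have h1 : ∮ z in C(0, ρ), (z - w)⁻¹ • f z =
        ∮ z in C(0, ρ), (W.eval w * ((z - w)⁻¹ • h z) + h z * G.eval z) := by
      refine circleIntegral.integral_congr hρ.le fun z hz => ?_
      simp only [smul_eq_mul]
      rw [hfh z hz, hG z]
      field_simp [hne z hz]
    rw [h1, circleIntegral.integral_add, hGint, add_zero, circleIntegral.integral_const_mul,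
      mul_comm]
    · refine hci _ (ContinuousOn.mul continuousOn_const (ContinuousOn.fun_smul ?_ hh))
      exact ContinuousOn.inv₀ (by fun_prop) hne
    · exact hci _ (by fun_prop)
  rw [smul_mul_assoc, ← hsplit, hC, smul_smul, inv_mul_cancel₀ Complex.two_pi_I_ne_zero, one_smul]

/-- The Cauchy transform of a function close to `1` does not vanish well inside the circle. -/
theorem cauchyTransform_ne_zero {ρ : ℝ} (hρ : 0 < ρ) {h : ℂ → ℂ}
    (hh : ContinuousOn h (Metric.sphere 0 ρ))
    (hclose : ∀ z ∈ Metric.sphere (0 : ℂ) ρ, ‖h z - 1‖ ≤ 1 / 4) {w : ℂ}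
    (hw : w ∈ Metric.ball (0 : ℂ) (ρ / 2)) :
    ((2 * (Real.pi : ℂ) * Complex.I)⁻¹ • ∮ z in C(0, ρ), (z - w)⁻¹ • h z) ≠ 0 := by
  have hw' : w ∈ Metric.ball (0 : ℂ) ρ := Metric.ball_subset_ball (by linarith) hw
  have hlow : ∀ z ∈ Metric.sphere (0 : ℂ) ρ, ρ / 2 ≤ ‖z - w‖ := by
    intro z hz
    simp only [mem_sphere_iff_norm, sub_zero, Metric.mem_ball, dist_zero_right] at hz hw
    have := norm_sub_norm_le z w
    linarith
  have hne : ∀ z ∈ Metric.sphere (0 : ℂ) ρ, z - w ≠ 0 := fun z hz h0 => by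
    have := hlow z hz
    rw [h0, norm_zero] at this
    linarith
  have hcinv : ContinuousOn (fun z : ℂ => (z - w)⁻¹) (Metric.sphere 0 ρ) :=
    ContinuousOn.inv₀ (by fun_prop) hne
  -- The Cauchy transform of 1 is 1, so the deviation from 1 is at most ρ · (2/ρ) · (1/4) = 1/2.
  have hdiff : ((2 * (Real.pi : ℂ) * Complex.I)⁻¹ • ∮ z in C(0, ρ), (z - w)⁻¹ • h z) - 1 =
      (2 * (Real.pi : ℂ) * Complex.I)⁻¹ • ∮ z in C(0, ρ), (z - w)⁻¹ • (h z - 1) := by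
    have h1 : ∮ z in C(0, ρ), (z - w)⁻¹ • (h z - 1) =
        (∮ z in C(0, ρ), (z - w)⁻¹ • h z) - ∮ z in C(0, ρ), (z - w)⁻¹ := by
      rw [← circleIntegral.integral_sub ((hcinv.fun_smul hh).circleIntegrable hρ.le)
        (hcinv.circleIntegrable hρ.le)]
      simp only [smul_eq_mul, mul_sub, mul_one]
    rw [h1, circleIntegral.integral_sub_inv_of_mem_ball hw', smul_sub, smul_eq_mul (b := _ * _),
      inv_mul_cancel₀ Complex.two_pi_I_ne_zero]
  have hbound : ‖((2 * (Real.pi : ℂ) * Complex.I)⁻¹ • ∮ z in C(0, ρ), (z - w)⁻¹ • h z) - 1‖ ≤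
      ρ * ((ρ / 2)⁻¹ * (1 / 4)) := by
    rw [hdiff]
    refine circleIntegral.norm_two_pi_i_inv_smul_integral_le_of_norm_le_const hρ.le fun z hz => ?_
    rw [norm_smul, norm_inv]
    gcongr
    · exact hlow z hz
    · exact hclose z hz
  intro h0
  rw [h0, zero_sub, norm_neg, norm_one] at hbound
  have : ρ * ((ρ / 2)⁻¹ * (1 / 4)) = 1 / 2 := by field_simp; norm_num
  linarith

end RamifiedBurgers

/-! ### Weierstrass preparation by the implicit function theorem -/

namespace RamifiedBurgers

theorem exists_closedBall_radius {r : ENNReal} (hr : 0 < r) {P : ℂ → Prop}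
    (hP : ∀ᶠ z in 𝓝 (0 : ℂ), P z) :
    ∃ ρ : ℝ, 0 < ρ ∧ ENNReal.ofReal ρ < r ∧ ∀ z ∈ Metric.closedBall (0 : ℂ) ρ, P z := by
  obtain ⟨ε, hε, h⟩ := Metric.eventually_nhds_iff_ball.1 hP
  obtain ⟨s, hs0, hsr⟩ := ENNReal.lt_iff_exists_nnreal_btwn.1 hr
  have hs : (0 : ℝ) < s := by exact_mod_cast hs0
  refine ⟨min s (ε / 2), by positivity, lt_of_le_of_lt ?_ hsr, fun z hz => h z ?_⟩
  · calc ENNReal.ofReal (min s (ε / 2)) ≤ ENNReal.ofReal s :=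
          ENNReal.ofReal_le_ofReal (min_le_left _ _)
      _ = s := ENNReal.ofReal_coe_nnreal
  · refine Metric.closedBall_subset_ball ?_ hz
    exact lt_of_le_of_lt (min_le_right _ _) (by linarith)

/-- **Weierstrass preparation theorem**: a holomorphic function `f` of `(x, z)` near `(0, 0)` with
`f(0, z) = z ^ p` is the product of a monic polynomial of degree `p` in `z`, with coefficients
holomorphic in `x`, and of a function without zeros; the polynomial is unique. -/
theorem weierstrass_preparation {E : Type*} [NormedAddCommGroup E] [NormedSpace ℂ E]
    [CompleteSpace E] {p : ℕ} [NeZero p] {f : E × ℂ → ℂ} (hf : AnalyticAt ℂ f 0)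
    (hf₀ : ∀ᶠ z in 𝓝 (0 : ℂ), f (0, z) = z ^ p) :
    ∃ a : E → Fin p → ℂ, AnalyticAt ℂ a 0 ∧ a 0 = 0 ∧
      (∃ δ > 0, ∀ᶠ x in 𝓝 (0 : E), ∃ Q : ℂ → ℂ, ∀ z ∈ Metric.ball (0 : ℂ) δ,
        DifferentiableAt ℂ Q z ∧ Q z ≠ 0 ∧ f (x, z) = Q z * (weierstrassPoly (a x)).eval z) ∧
      ∀ᶠ w in 𝓝 (0 : E × (Fin p → ℂ)),
        (∀ z, f (w.1, z) = (weierstrassPoly w.2).eval z) → w.2 = a w.1 := by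
  obtain ⟨s, r, hs⟩ := hf
  obtain ⟨ρ, hρ, hρr, hρ₀⟩ := exists_closedBall_radius hs.r_pos hf₀
  let K := Metric.sphere (0 : ℂ) ρ
  have : CompactSpace K := isCompact_iff_compactSpace.1 (isCompact_sphere _ _)
  have hK0 : ∀ z : K, (z : ℂ) ≠ 0 := fun z hz => by
    have := z.2
    rw [mem_sphere_iff_norm, hz, sub_zero, norm_zero] at this
    exact hρ.ne this
  obtain ⟨N, hN, hNf⟩ := hs.exists_analyticAt_comp_continuousMap K
  -- the restriction of `f x` to the circle depends holomorphically on `x`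
  let ξ : C(K, ℂ) := ⟨fun z => z, continuous_subtype_val⟩
  let e₀ : C(K, E × ℂ) := ⟨fun z => (0, z), by fun_prop⟩
  let L : E →L[ℂ] C(K, E × ℂ) := (ContinuousLinearMap.const ℂ K).comp (.inl ℂ E ℂ)
  have hL : ∀ x (z : K), (e₀ + L x) z = (x, (z : ℂ)) := fun x z => by
    change ((0 : E), (z : ℂ)) + (x, (0 : ℂ)) = _
    simp
  have hLcont : Continuous fun x => e₀ + L x := by fun_prop
  have hLan : AnalyticAt ℂ (fun x => e₀ + L x) 0 :=
    analyticAt_const.add (L.analyticAt 0)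
  have he₀ : e₀ + L 0 ∈ Metric.eball (0 : C(K, E × ℂ)) r := by
    rw [map_zero, add_zero, Metric.mem_eball, edist_zero_right, ← ofReal_norm]
    refine lt_of_le_of_lt (ENNReal.ofReal_le_ofReal ?_) hρr
    refine (ContinuousMap.norm_le _ hρ.le).2 fun z => ?_
    have := z.2
    rw [mem_sphere_iff_norm, sub_zero] at this
    simp [e₀, Prod.norm_def, this, hρ.le]
  have hmem : ∀ᶠ x in 𝓝 (0 : E), e₀ + L x ∈ Metric.eball (0 : C(K, E × ℂ)) r :=
    hLcont.continuousAt.eventually (Metric.isOpen_eball.mem_nhds he₀)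
  let 𝓕 : E → C(K, ℂ) := fun x => N (e₀ + L x)
  have h𝓕an : AnalyticAt ℂ 𝓕 0 := AnalyticAt.fun_comp (g := N) (f := fun x => e₀ + L x) (hN _ he₀) hLan
  have h𝓕 : ∀ᶠ x in 𝓝 (0 : E), ∀ z : K, 𝓕 x z = f (x, z) := by
    filter_upwards [hmem] with x hx z
    rw [hNf _ hx, hL]
  have h𝓕0 : 𝓕 0 = ξ ^ p := by
    ext z
    rw [h𝓕.self_of_nhds, hρ₀ _ (Metric.sphere_subset_closedBall z.2)]
    simp [ξ]
  let 𝓦 : (Fin p → ℂ) → C(K, ℂ) := fun b => ξ ^ p - ∑ j : Fin p, b j • ξ ^ (j : ℕ)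
  have h𝓦 : ∀ b (z : K), 𝓦 b z = (weierstrassPoly b).eval (z : ℂ) := by
    intro b z
    simp [𝓦, ξ, eval_weierstrassPoly, ContinuousMap.sum_apply]
  have h𝓦an : ∀ b, AnalyticAt ℂ 𝓦 b := by
    intro b
    refine analyticAt_const.sub (Finset.analyticAt_fun_sum _ fun j _ => ?_)
    exact ((ContinuousLinearMap.proj (R := ℂ) (φ := fun _ : Fin p => ℂ) j).analyticAt b).smul
      analyticAt_const
  have hξu : IsUnit (ξ ^ p) := by
    rw [ContinuousMap.isUnit_iff_forall_isUnit]
    intro z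
    simpa [ξ] using fun h => absurd h (hK0 z)
  obtain ⟨η, hη⟩ := hξu
  have h𝓦0 : 𝓦 0 = η := by simp [𝓦, hη]
  -- This is the quotient f(x, ·) / W_b on the circle. It should extend holomorphically to the disc,
  -- for which the vanishing of its first p moments suffices; these are p equations for the p
  -- unknowns b.
  let H : E × (Fin p → ℂ) → C(K, ℂ) := fun w => 𝓕 w.1 * Ring.inverse (𝓦 w.2)
  have hHan : AnalyticAt ℂ H 0 := by
    refine (AnalyticAt.fun_comp (g := 𝓕) (f := Prod.fst) h𝓕an analyticAt_fst).mul
      (AnalyticAt.fun_comp (g := Ring.inverse) (f := fun w : E × (Fin p → ℂ) => 𝓦 w.2) ?_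
        (AnalyticAt.fun_comp (g := 𝓦) (h𝓦an _) analyticAt_snd))
    change AnalyticAt ℂ Ring.inverse (𝓦 0)
    rw [h𝓦0]
    exact analyticAt_inverse η
  have hH0 : H 0 = 1 := by
    change 𝓕 0 * Ring.inverse (𝓦 0) = 1
    rw [h𝓕0, h𝓦0, ← hη, Ring.inverse_unit, Units.mul_inv]
  let ℓ := circleResidue (ρ := ρ) hρ.le
  -- The moments are listed in reverse order so that the derivative in b is the identity rather than
  -- a permutation matrix.
  let M : E × (Fin p → ℂ) → (Fin p → ℂ) := fun w i => ℓ (H w * ξ ^ (p - 1 - (i : ℕ)))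
  have hMan : AnalyticAt ℂ M 0 := by
    refine analyticAt_pi_iff.2 fun i => ?_
    exact (ℓ.analyticAt _).comp (hHan.mul analyticAt_const)
  have hM1 : ∀ w, H w = 1 → M w = 0 := by
    intro w hw
    ext i
    change ℓ (H w * _) = 0
    rw [hw, one_mul]
    refine (circleResidue_zpow hρ (p - 1 - (i : ℕ) : ℕ) fun z => ?_).trans (if_neg (by omega))
    simp [ξ]
  have hM0 : M ((0 : E), (0 : Fin p → ℂ)) = 0 := hM1 _ hH0
  -- The derivative of z^p / (z^p - ∑ b_j z^j) at b = 0 is ∑ b_j z^(j-p). After multiplication by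
  -- z^(p-1-i) the exponent is j - i - 1, and the residue selects j = i.
  have hdM : ∀ b, fderiv ℂ M 0 (0, b) = b := by
    intro b
    let B : C(K, ℂ) := ∑ j : Fin p, b j • ξ ^ (j : ℕ)
    have hline : ∀ c : ℂ, 𝓦 (c • b) = η - c • B := by
      intro c
      simp [𝓦, B, hη, Finset.smul_sum, smul_smul]
    have h1 : HasDerivAt (fun c : ℂ => (η : C(K, ℂ)) - c • B) (-B) 0 := by
      simpa using ((hasDerivAt_id (0 : ℂ)).smul_const B).const_sub (η : C(K, ℂ))
    have h2 : HasFDerivAt Ring.inverse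
        (-(ContinuousLinearMap.mulLeftRight ℂ C(K, ℂ) ↑η⁻¹ ↑η⁻¹)) ((η : C(K, ℂ)) - (0 : ℂ) • B) := by
      simpa using hasFDerivAt_ringInverse (𝕜 := ℂ) η
    have h3 := h2.comp_hasDerivAt (0 : ℂ) h1
    have h4 : ∀ i : Fin p, HasDerivAt (fun c : ℂ => M (0, c • b) i) (b i) 0 := by
      intro i
      have h5 := ℓ.hasFDerivAt.comp_hasDerivAt (0 : ℂ)
        ((h3.const_mul (ξ ^ p)).mul_const (ξ ^ (p - 1 - (i : ℕ))))
      refine (h5.congr_deriv ?_).congr_of_eventuallyEq (Eventually.of_forall fun c => ?_)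
      · have h6 : ξ ^ p * (-(ContinuousLinearMap.mulLeftRight ℂ C(K, ℂ) ↑η⁻¹ ↑η⁻¹)) (-B) *
            ξ ^ (p - 1 - (i : ℕ)) =
            ∑ j : Fin p, b j • ((↑η⁻¹ : C(K, ℂ)) * ξ ^ (j : ℕ) * ξ ^ (p - 1 - (i : ℕ))) := by
          have h7 : ξ ^ p * (↑η⁻¹ : C(K, ℂ)) = 1 := by rw [← hη, Units.mul_inv]
          calc ξ ^ p * (-(ContinuousLinearMap.mulLeftRight ℂ C(K, ℂ) ↑η⁻¹ ↑η⁻¹)) (-B) *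
                ξ ^ (p - 1 - (i : ℕ))
              = ξ ^ p * (↑η⁻¹ : C(K, ℂ)) * (B * (↑η⁻¹ : C(K, ℂ)) * ξ ^ (p - 1 - (i : ℕ))) := by
                simp only [neg_apply, ContinuousLinearMap.mulLeftRight_apply]
                ring
            _ = _ := by
                rw [h7, one_mul]
                simp only [B, Finset.sum_mul]
                refine Finset.sum_congr rfl fun j _ => ?_
                simp only [smul_mul_assoc]
                congr 2
                ring
        rw [h6, map_sum]
        simp only [map_smul]
        have h8 : ∀ j : Fin p,
            ℓ ((↑η⁻¹ : C(K, ℂ)) * ξ ^ (j : ℕ) * ξ ^ (p - 1 - (i : ℕ))) =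
              if j = i then 1 else 0 := by
          intro j
          have hηz : ∀ z : K, (↑η⁻¹ : C(K, ℂ)) z = ((z : ℂ) ^ p)⁻¹ := by
            intro z
            have := congrArg (fun g : C(K, ℂ) => g z) (Units.mul_inv η)
            simp only [ContinuousMap.mul_apply, hη, ContinuousMap.one_apply] at this
            exact eq_inv_of_mul_eq_one_right this
          refine (circleResidue_zpow hρ ((j : ℤ) - i - 1) fun z => ?_).trans ?_
          · simp only [ContinuousMap.mul_apply, hηz, ContinuousMap.pow_apply]
            change ((z : ℂ) ^ p)⁻¹ * (z : ℂ) ^ (j : ℕ) * (z : ℂ) ^ (p - 1 - (i : ℕ)) = _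
            rw [← zpow_natCast, ← zpow_natCast, ← zpow_natCast, ← zpow_neg, ← zpow_add₀ (hK0 z),
              ← zpow_add₀ (hK0 z)]
            congr 1
            have := i.2
            omega
          · refine if_congr ?_ rfl rfl
            rw [Fin.ext_iff]
            omega
        simp [h8]
      · change ℓ (𝓕 0 * Ring.inverse (𝓦 (c • b)) * _) = _
        rw [h𝓕0, hline]
        rfl
    have h9 : HasDerivAt (fun c : ℂ => M (0, c • b)) b 0 := hasDerivAt_pi.2 h4
    have h10 : HasDerivAt (fun c : ℂ => ((0 : E), c • b)) (0, b) 0 := by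
      simpa using (hasDerivAt_const (0 : ℂ) (0 : E)).prodMk ((hasDerivAt_id (0 : ℂ)).smul_const b)
    have h11 : HasFDerivAt M (fderiv ℂ M 0) ((0 : E), (0 : ℂ) • b) := by
      rw [zero_smul]
      exact hMan.differentiableAt.hasFDerivAt
    exact (HasFDerivAt.comp_hasDerivAt (l := M) (0 : ℂ) h11 h10).unique h9
  have hinv : (fderiv ℂ M ((0 : E), (0 : Fin p → ℂ)) ∘L .inr ℂ E (Fin p → ℂ)).IsInvertible := by
    refine ⟨ContinuousLinearEquiv.refl ℂ _, ?_⟩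
    ext1 b
    exact (hdM b).symm
  obtain ⟨a, haan, ha0, haM, hau⟩ := AnalyticAt.exists_implicitFunction hMan hM0 hinv
  -- The quotient is the Cauchy transform of H. It is controlled only at a distance from the circle,
  -- hence the half radius.
  refine ⟨a, haan, ha0, ⟨ρ / 2, by positivity, ?_⟩, ?_⟩
  · have hcont : ContinuousAt (fun x : E => (x, a x)) 0 :=
      continuousAt_id.prodMk haan.continuousAt
    have hcont0 : ((0 : E), a 0) = 0 := by simp [ha0]
    have hclose : ∀ᶠ x in 𝓝 (0 : E), ‖H (x, a x) - 1‖ < 1 / 4 := by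
      have h1 : ContinuousAt (fun x => ‖H (x, a x) - 1‖) 0 :=
        ((ContinuousAt.comp (g := H) (by simpa only [hcont0] using hHan.continuousAt) hcont).sub
          continuousAt_const).norm
      refine h1.eventually_lt continuousAt_const ?_
      have : H (0, a 0) = 1 := by rw [ha0]; exact hH0
      simp [this]
    have hunit : ∀ᶠ x in 𝓝 (0 : E), IsUnit (𝓦 (a x)) := by
      have h1 : ContinuousAt (fun x => 𝓦 (a x)) 0 :=
        ContinuousAt.comp (g := 𝓦) (h𝓦an _).continuousAt haan.continuousAt
      refine h1.eventually ?_
      change {y | IsUnit y} ∈ 𝓝 (𝓦 (a 0))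
      rw [ha0, h𝓦0]
      exact η.nhds
    have hdiff : ∀ᶠ x in 𝓝 (0 : E), ∀ z ∈ Metric.closedBall (0 : ℂ) ρ,
        (x, z) ∈ Metric.eball (0 : E × ℂ) r := by
      have : ∀ᶠ x in 𝓝 (0 : E), ‖x‖ < ρ := by
        filter_upwards [Metric.ball_mem_nhds (0 : E) hρ] with x hx
        simpa using hx
      filter_upwards [this] with x hx z hz
      rw [Metric.mem_eball, edist_zero_right, ← ofReal_norm]
      refine lt_of_le_of_lt (ENNReal.ofReal_le_ofReal ?_) hρr
      rw [mem_closedBall_zero_iff] at hz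
      exact max_le hx.le hz
    filter_upwards [haM, hclose, hunit, hdiff, h𝓕] with x hx1 hx2 hx3 hx4 hx5
    set h := circleExt (H (x, a x))
    have hhc := continuousOn_circleExt (H (x, a x))
    have hhcl : ∀ z ∈ Metric.sphere (0 : ℂ) ρ, ‖h z - 1‖ ≤ 1 / 4 := by
      intro z hz
      rw [show h z = _ from circleExt_of_mem _ hz]
      exact ((H (x, a x) - 1).norm_coe_le_norm ⟨z, hz⟩).trans hx2.le
    refine ⟨fun w => (2 * (Real.pi : ℂ) * Complex.I)⁻¹ • ∮ z in C(0, ρ), (z - w)⁻¹ • h z,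
      fun z hz => ⟨?_, cauchyTransform_ne_zero hρ hhc hhcl hz, ?_⟩⟩
    · lift ρ to NNReal using hρ.le
      refine ((hasFPowerSeriesOn_cauchy_integral (hhc.circleIntegrable hρ.le)
        (by exact_mod_cast hρ)).analyticAt_of_mem ?_).differentiableAt
      rw [Metric.mem_eball, edist_zero_right, ← ofReal_norm]
      rw [mem_ball_zero_iff] at hz
      rw [← ENNReal.ofReal_coe_nnreal]
      exact (ENNReal.ofReal_lt_ofReal_iff hρ).2 (by linarith)
    · refine eq_cauchyTransform_mul_of_moments_eq_zero hρ (a x) (f := fun z => f (x, z))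
        (h := h) ?_ hhc ?_ ?_ (Metric.ball_subset_ball (by linarith) hz)
      · intro y hy
        refine DifferentiableAt.differentiableWithinAt ?_
        exact (hs.analyticAt_of_mem (hx4 y hy)).differentiableAt.comp y (by fun_prop)
      · intro y hy
        rw [show h y = _ from circleExt_of_mem _ hy, ← h𝓦 _ ⟨y, hy⟩, ← hx5 ⟨y, hy⟩,
          ← ContinuousMap.mul_apply]
        change _ = (𝓕 x * Ring.inverse (𝓦 (a x)) * 𝓦 (a x)) ⟨y, hy⟩
        rw [mul_assoc, Ring.inverse_mul_cancel _ hx3, mul_one]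
      · intro k hk
        have hk' := congrFun hx1 ⟨p - 1 - k, by omega⟩
        change ℓ (H (x, a x) * ξ ^ (p - 1 - (p - 1 - k))) = 0 at hk'
        rw [show p - 1 - (p - 1 - k) = k by omega] at hk'
        have hk'' := circleResidue_apply hρ.le (f := H (x, a x) * ξ ^ k)
          (g := fun z => h z * z ^ k) fun z => by
            rw [show h z = _ from circleExt_of_mem _ z.2]
            rfl
        have := hk''.symm.trans hk'
        exact (mul_eq_zero.1 this).resolve_left (inv_ne_zero Complex.two_pi_I_ne_zero)
  -- If f(x, ·) is itself a polynomial W_b, then the quotient is 1 and all its moments vanish, so b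
  -- is the local solution of the moment equations.
  · have hunit : ∀ᶠ w in 𝓝 (0 : E × (Fin p → ℂ)), IsUnit (𝓦 w.2) := by
      have h1 : ContinuousAt (fun w : E × (Fin p → ℂ) => 𝓦 w.2) 0 :=
        ContinuousAt.comp (g := 𝓦) (h𝓦an _).continuousAt continuousAt_snd
      refine h1.eventually ?_
      change _ ∈ 𝓝 (𝓦 0)
      rw [h𝓦0]
      exact η.nhds
    filter_upwards [hau, hunit, continuousAt_fst.eventually h𝓕] with w hw1 hw2 hw3 hw
    refine hw1 (hM1 w ?_)
    have : 𝓕 w.1 = 𝓦 w.2 := by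
      ext z
      rw [hw3, h𝓦, hw]
    change 𝓕 w.1 * Ring.inverse (𝓦 w.2) = 1
    rw [this, Ring.mul_inverse_cancel _ hw2]

end RamifiedBurgers

/-! ### Discriminants and dependence of roots on coefficients -/

namespace RamifiedBurgers

section Discriminant

open Polynomial

variable {p : ℕ}

theorem coeff_weierstrassPoly (a : Fin p → ℂ) (k : ℕ) :
    (weierstrassPoly a).coeff k =
      (if k = p then 1 else 0) - ∑ j : Fin p, a j * if k = (j : ℕ) then 1 else 0 := by
  simp [weierstrassPoly, coeff_X_pow, finsetSum_coeff]

theorem eval_derivative_weierstrassPoly (a : Fin p → ℂ) (z : ℂ) :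
    (derivative (weierstrassPoly a)).eval z =
      p * z ^ (p - 1) - ∑ j : Fin p, a j * (((j : ℕ) : ℂ) * z ^ ((j : ℕ) - 1)) := by
  simp [weierstrassPoly, derivative_X_pow, eval_finsetSum]

theorem natDegree_derivative_weierstrassPoly (a : Fin p → ℂ) :
    (derivative (weierstrassPoly a)).natDegree = p - 1 := by
  rw [natDegree_derivative, natDegree_weierstrassPoly]

/-- The resultant of `X ^ p - ∑ j, a j X ^ j` and its derivative. -/
noncomputable def weierstrassDisc (a : Fin p → ℂ) : ℂ :=
  resultant (weierstrassPoly a) (derivative (weierstrassPoly a)) p (p - 1)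

/-- In characteristic 0 the derivative has degree exactly p - 1, so the sizes in the resultant are
the true degrees. Its vanishing means failure of coprimality, which over ℂ is a common root. For p =
1 the derivative is 1 and there is none. -/
theorem weierstrassDisc_eq_zero_iff (a : Fin p → ℂ) :
    weierstrassDisc a = 0 ↔ ∃ z, (weierstrassPoly a).eval z = 0 ∧
      (derivative (weierstrassPoly a)).eval z = 0 := by
  have h := resultant_eq_zero_iff (f := weierstrassPoly a) (g := derivative (weierstrassPoly a))
  rw [natDegree_weierstrassPoly, natDegree_derivative_weierstrassPoly] at h
  rw [weierstrassDisc, h, and_iff_right (Or.inl (monic_weierstrassPoly a).ne_zero),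
    isCoprime_iff_aeval_ne_zero_of_isAlgClosed ℂ ℂ]
  push Not
  simp [aeval_def]

theorem analyticAt_weierstrassDisc (a : Fin p → ℂ) : AnalyticAt ℂ weierstrassDisc a := by
  have hc : ∀ k, AnalyticAt ℂ (fun a : Fin p → ℂ => (weierstrassPoly a).coeff k) a := by
    intro k
    simp only [coeff_weierstrassPoly]
    refine analyticAt_const.sub (Finset.analyticAt_fun_sum _ fun j _ => ?_)
    exact ((ContinuousLinearMap.proj (R := ℂ) (φ := fun _ : Fin p => ℂ) j).analyticAt a).mul
      analyticAt_const
  have hd : ∀ k, AnalyticAt ℂ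
      (fun a : Fin p → ℂ => (derivative (weierstrassPoly a)).coeff k) a := by
    intro k
    simp only [coeff_derivative]
    exact (hc _).mul analyticAt_const
  unfold weierstrassDisc resultant
  simp only [Matrix.det_apply]
  refine Finset.analyticAt_fun_sum _ fun σ _ => ?_
  simp only [Units.smul_def, zsmul_eq_mul]
  refine analyticAt_const.mul (Finset.analyticAt_fun_prod _ fun i _ => ?_)
  simp only [sylvester, Matrix.of_apply]
  induction i using Fin.addCases with
  | left i =>
    simp only [Fin.addCases_left]
    split_ifs
    exacts [hd _, analyticAt_const]
  | right i =>
    simp only [Fin.addCases_right]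
    split_ifs
    exacts [hc _, analyticAt_const]

theorem isRootAt_iff {n : ℕ} {a : Fin p → SpaceTime n → ℂ} {q : SpaceTime n} {ζ : ℂ} :
    IsRootAt a q ζ ↔ (weierstrassPoly fun j => a j q).eval ζ = 0 := by
  rw [IsRootAt, eval_weierstrassPoly, sub_eq_zero]

theorem isMultipleRootAt_iff {n : ℕ} {a : Fin p → SpaceTime n → ℂ} {q : SpaceTime n} {ζ : ℂ} :
    IsMultipleRootAt a q ζ ↔ (weierstrassPoly fun j => a j q).eval ζ = 0 ∧
      (derivative (weierstrassPoly fun j => a j q)).eval ζ = 0 := by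
  rw [IsMultipleRootAt, isRootAt_iff, eval_derivative_weierstrassPoly, sub_eq_zero]

end Discriminant

section Roots

variable {p : ℕ}

/-- Cauchy's root bound applied with the value at z absorbed into the constant coefficient. Allowing
a nonzero value is what makes `polyFamily` proper. -/
theorem norm_le_of_eval_weierstrassPoly [NeZero p] (a : Fin p → ℂ) (z : ℂ) :
    ‖z‖ ≤ 1 + ∑ j, ‖a j‖ + ‖(weierstrassPoly a).eval z‖ := by
  by_contra! h
  set b := (weierstrassPoly a).eval z with hb
  have hS : 0 ≤ ∑ j, ‖a j‖ := Finset.sum_nonneg fun _ _ => norm_nonneg _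
  have hb0 := norm_nonneg b
  have h1 : 1 ≤ ‖z‖ := by linarith
  have hp : p - 1 + 1 = p := Nat.sub_add_cancel (NeZero.one_le)
  have hz : z ^ p = ∑ j : Fin p, a j * z ^ (j : ℕ) + b := by
    rw [hb, eval_weierstrassPoly]; ring
  have h2 : ‖z‖ ^ p ≤ (∑ j, ‖a j‖ + ‖b‖) * ‖z‖ ^ (p - 1) := by
    rw [← norm_pow, hz, add_mul, Finset.sum_mul]
    refine (norm_add_le _ _).trans (add_le_add ((norm_sum_le _ _).trans ?_) ?_)
    · refine Finset.sum_le_sum fun j _ => ?_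
      rw [norm_mul, norm_pow]
      gcongr
      have := j.2
      omega
    · exact le_mul_of_one_le_right hb0 (one_le_pow₀ h1)
  have h3 : ‖z‖ ^ p = ‖z‖ * ‖z‖ ^ (p - 1) := by rw [← pow_succ', hp]
  rw [h3] at h2
  have := le_of_mul_le_mul_right h2 (by positivity)
  linarith

/-- For ‖z‖ ≥ δ one has ‖z‖^j ≤ δ^(j-p) ‖z‖^p, so small coefficients cannot balance z^p. This
confines all roots to the disc where the Weierstrass factorization is valid. -/
theorem eventually_norm_root_lt {δ : ℝ} (hδ : 0 < δ) :
    ∀ᶠ a in 𝓝 (0 : Fin p → ℂ), ∀ z, (weierstrassPoly a).eval z = 0 → ‖z‖ < δ := by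
  have hc : Continuous fun a : Fin p → ℂ => ∑ j : Fin p, ‖a j‖ * (δ ^ (p - (j : ℕ)))⁻¹ := by
    fun_prop
  have he : ∀ᶠ a in 𝓝 (0 : Fin p → ℂ), ∑ j : Fin p, ‖a j‖ * (δ ^ (p - (j : ℕ)))⁻¹ < 1 :=
    hc.continuousAt.eventually_lt continuousAt_const (by simp)
  filter_upwards [he] with a ha z hz
  by_contra! h
  have hz0 : 0 < ‖z‖ := hδ.trans_le h
  rw [eval_weierstrassPoly, sub_eq_zero] at hz
  have h1 : ‖z‖ ^ p ≤ (∑ j : Fin p, ‖a j‖ * (δ ^ (p - (j : ℕ)))⁻¹) * ‖z‖ ^ p := by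
    conv_lhs => rw [← norm_pow, hz]
    rw [Finset.sum_mul]
    refine (norm_sum_le _ _).trans (Finset.sum_le_sum fun j _ => ?_)
    rw [norm_mul, norm_pow, mul_assoc]
    gcongr
    have h2 : ‖z‖ ^ p = ‖z‖ ^ (p - (j : ℕ)) * ‖z‖ ^ (j : ℕ) := by
      rw [← pow_add, Nat.sub_add_cancel j.2.le]
    rw [h2, ← mul_assoc]
    refine le_mul_of_one_le_left (by positivity) ?_
    rw [inv_mul_eq_div, one_le_div (by positivity)]
    gcongr
  have h3 : 0 < ‖z‖ ^ p := by positivity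
  nlinarith

theorem analyticAt_eval_weierstrassPoly (w : (Fin p → ℂ) × ℂ) :
    AnalyticAt ℂ (fun w : (Fin p → ℂ) × ℂ => (weierstrassPoly w.1).eval w.2) w := by
  simp only [eval_weierstrassPoly]
  refine (analyticAt_snd.pow p).sub (Finset.analyticAt_fun_sum _ fun j _ => ?_)
  refine AnalyticAt.mul ?_ (analyticAt_snd.pow _)
  exact AnalyticAt.fun_comp
    (g := ContinuousLinearMap.proj (R := ℂ) (φ := fun _ : Fin p => ℂ) j)
    (ContinuousLinearMap.analyticAt _ _) analyticAt_fst

/-- A simple root depends holomorphically on the coefficients, and is locally unique. -/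
theorem exists_analyticAt_root {E : Type*} [NormedAddCommGroup E] [NormedSpace ℂ E]
    [CompleteSpace E] {A : E → Fin p → ℂ} {q : E} (hA : AnalyticAt ℂ A q) {ζ : ℂ}
    (hζ : (weierstrassPoly (A q)).eval ζ = 0)
    (hζ' : (Polynomial.derivative (weierstrassPoly (A q))).eval ζ ≠ 0) :
    ∃ z : E → ℂ, AnalyticAt ℂ z q ∧ z q = ζ ∧
      (∀ᶠ q' in 𝓝 q, (weierstrassPoly (A q')).eval (z q') = 0) ∧
      ∀ᶠ w in 𝓝 (q, ζ), (weierstrassPoly (A w.1)).eval w.2 = 0 → w.2 = z w.1 := by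
  have han : AnalyticAt ℂ (fun w : E × ℂ => (weierstrassPoly (A w.1)).eval w.2) (q, ζ) := by
    refine AnalyticAt.fun_comp (g := fun w : (Fin p → ℂ) × ℂ => (weierstrassPoly w.1).eval w.2)
      (f := fun w : E × ℂ => (A w.1, w.2)) (analyticAt_eval_weierstrassPoly _) ?_
    exact (AnalyticAt.fun_comp (g := A) (f := Prod.fst) hA analyticAt_fst).prod analyticAt_snd
  refine AnalyticAt.exists_implicitFunction han hζ
    ⟨ContinuousLinearEquiv.unitsEquivAut ℂ (Units.mk0 _ hζ'), ?_⟩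
  ext
  have h1 : HasDerivAt (fun z : ℂ => (q, z)) (0, 1) ζ :=
    (hasDerivAt_const ζ q).prodMk (hasDerivAt_id ζ)
  have h2 := HasFDerivAt.comp_hasDerivAt ζ han.differentiableAt.hasFDerivAt h1
  have h3 := h2.unique ((weierstrassPoly (A q)).hasDerivAt ζ)
  simpa using h3.symm

end Roots

/-! ### The covering by simple roots and continuation along paths -/

section Covering

variable {p : ℕ}

/-- The family of all monic polynomials of degree `p`, over the space of coefficients. -/
noncomputable def polyFamily (w : (Fin p → ℂ) × ℂ) : (Fin p → ℂ) × ℂ :=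
  (w.1, (weierstrassPoly w.1).eval w.2)

theorem analyticAt_polyFamily (w : (Fin p → ℂ) × ℂ) : AnalyticAt ℂ polyFamily w :=
  analyticAt_fst.prod (analyticAt_eval_weierstrassPoly w)

theorem continuous_polyFamily : Continuous (polyFamily (p := p)) :=
  continuous_iff_continuousAt.2 fun w => (analyticAt_polyFamily w).continuousAt

theorem isClosedMap_polyFamily [NeZero p] : IsClosedMap (polyFamily (p := p)) := by
  refine IsProperMap.isClosedMap (isProperMap_iff_isCompact_preimage.2
    ⟨continuous_polyFamily, fun K hK => ?_⟩)
  refine Metric.isCompact_of_isClosed_isBounded (hK.isClosed.preimage continuous_polyFamily) ?_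
  obtain ⟨R, hR⟩ := hK.isBounded.exists_norm_le
  rw [isBounded_iff_forall_norm_le]
  refine ⟨1 + p * R + R, fun w hw => ?_⟩
  have h := hR _ hw
  have h1 : ‖w.1‖ ≤ R := (norm_fst_le (polyFamily w)).trans h
  have h2 : ‖(weierstrassPoly w.1).eval w.2‖ ≤ R := (norm_snd_le (polyFamily w)).trans h
  have hR0 : 0 ≤ R := (norm_nonneg _).trans h
  have hp : (1 : ℝ) ≤ p := by exact_mod_cast NeZero.one_le (n := p)
  refine max_le (h1.trans ?_) ((norm_le_of_eval_weierstrassPoly w.1 w.2).trans ?_)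
  · nlinarith
  · have : ∑ j, ‖w.1 j‖ ≤ ∑ _j : Fin p, R :=
      Finset.sum_le_sum fun j _ => (norm_le_pi_norm _ j).trans h1
    simp only [Finset.sum_const, Finset.card_univ, Fintype.card_fin, nsmul_eq_mul] at this
    linarith

/-- A closed map with finite fibres that is a local homeomorphism along them is a covering. Over the
given set every root is simple, which gives the local homeomorphism. -/
theorem isCoveringMapOn_polyFamily [NeZero p] :
    IsCoveringMapOn (polyFamily (p := p)) {w | weierstrassDisc w.1 ≠ 0 ∧ w.2 = 0} := by
  refine isClosedMap_polyFamily.isCoveringMapOn_of_isLocalHomeomorphOn ?_ ?_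
  · rintro ⟨a, b⟩ ⟨-, hb⟩
    simp only at hb
    subst hb
    refine (((weierstrassPoly a).roots.toFinset.finite_toSet).image fun z => (a, z)).subset ?_
    rintro ⟨a', z⟩ h
    obtain ⟨rfl, h2⟩ := Prod.mk.inj h
    exact ⟨z, by simpa [(monic_weierstrassPoly _).ne_zero] using h2, rfl⟩
  · rintro ⟨a, z⟩ ⟨hd, hz⟩
    simp only [polyFamily] at hd hz
    have hz' : (Polynomial.derivative (weierstrassPoly a)).eval z ≠ 0 := fun h =>
      hd ((weierstrassDisc_eq_zero_iff a).2 ⟨z, hz, h⟩)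
    set φ := fun w : (Fin p → ℂ) × ℂ => (weierstrassPoly w.1).eval w.2
    have hφ : HasStrictFDerivAt φ (fderiv ℂ φ (a, z)) (a, z) :=
      (analyticAt_eval_weierstrassPoly (a, z)).hasStrictFDerivAt
    -- The derivative is block triangular, with the identity and the nonzero number W'(z) on the
    -- diagonal.
    let T : ((Fin p → ℂ) × ℂ) ≃L[ℂ] (Fin p → ℂ) × ℂ :=
      ContinuousLinearEquiv.skewProd (ContinuousLinearEquiv.refl ℂ (Fin p → ℂ))
        (ContinuousLinearEquiv.unitsEquivAut ℂ (Units.mk0 _ hz'))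
        (fderiv ℂ φ (a, z) ∘L .inl ℂ (Fin p → ℂ) ℂ)
    have hT : HasStrictFDerivAt polyFamily (T : ((Fin p → ℂ) × ℂ) →L[ℂ] (Fin p → ℂ) × ℂ)
        (a, z) := by
      refine (hasStrictFDerivAt_fst.prodMk hφ).congr_fderiv ?_
      have h1 : HasDerivAt (fun y : ℂ => (a, y)) (0, 1) z :=
        (hasDerivAt_const z a).prodMk (hasDerivAt_id z)
      have h2 := (HasFDerivAt.comp_hasDerivAt z hφ.hasFDerivAt h1).unique
        ((weierstrassPoly a).hasDerivAt z)
      refine ContinuousLinearMap.ext fun w => Prod.ext (by simp [T]) ?_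
      have h3 : w = (w.1, 0) + w.2 • (0, 1) := by ext <;> simp
      have h4 : fderiv ℂ φ (a, z) w = fderiv ℂ φ (a, z) (w.1, 0) +
          w.2 * (Polynomial.derivative (weierstrassPoly a)).eval z := by
        conv_lhs => rw [h3, map_add, map_smul, h2, smul_eq_mul]
      simp [T, h4, add_comm]
    exact ⟨hT.toOpenPartialHomeomorph polyFamily, hT.mem_toOpenPartialHomeomorph_source,
      (hT.toOpenPartialHomeomorph_coe).symm⟩

/-- Roots of polynomials without multiple roots can be followed along paths of coefficients. -/
theorem exists_root_lift [NeZero p] (α : C(unitInterval, Fin p → ℂ))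
    (hα : ∀ τ, weierstrassDisc (α τ) ≠ 0) {ζ₀ : ℂ} (hζ₀ : (weierstrassPoly (α 0)).eval ζ₀ = 0) :
    ∃ ζ : C(unitInterval, ℂ), ζ 0 = ζ₀ ∧ ∀ τ, (weierstrassPoly (α τ)).eval (ζ τ) = 0 := by
  set S : Set ((Fin p → ℂ) × ℂ) := {w | weierstrassDisc w.1 ≠ 0 ∧ w.2 = 0}
  have hcov := (isCoveringMapOn_polyFamily (p := p)).isCoveringMap_restrictPreimage
  let γ : C(unitInterval, S) := ⟨fun τ => ⟨(α τ, 0), hα τ, rfl⟩, by fun_prop⟩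
  have he : polyFamily (α 0, ζ₀) = (α 0, 0) := by simp [polyFamily, hζ₀]
  let e : polyFamily ⁻¹' S := ⟨(α 0, ζ₀), by rw [Set.mem_preimage, he]; exact ⟨hα 0, rfl⟩⟩
  obtain ⟨Γ, hΓ, hΓ0⟩ := hcov.exists_path_lifts γ e (Subtype.ext he.symm)
  have hΓ' : ∀ τ, polyFamily (Γ τ : (Fin p → ℂ) × ℂ) = (α τ, 0) := fun τ =>
    congrArg Subtype.val (congrFun hΓ τ)
  refine ⟨⟨fun τ => (Γ τ : (Fin p → ℂ) × ℂ).2, by fun_prop⟩, by simp [hΓ0, e], fun τ => ?_⟩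
  obtain ⟨h1, h2⟩ := Prod.mk.inj (hΓ' τ)
  rw [← h1]
  exact h2

/-- A holomorphic branch of the algebraic function continues along every path that avoids the
branch locus. -/
theorem continuesAlong_add_root [NeZero p] {n : ℕ} {v : SpaceTime n → ℂ}
    {a : Fin p → SpaceTime n → ℂ} {γ : C(unitInterval, SpaceTime n)}
    (hv : ∀ τ, AnalyticAt ℂ v (γ τ)) (ha : ∀ τ j, AnalyticAt ℂ (a j) (γ τ))
    (hD : ∀ τ, weierstrassDisc (fun j => a j (γ τ)) ≠ 0) {z : SpaceTime n → ℂ}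
    (hz : IsAlgebraicGerm a (γ 0) z) : ContinuesAlong (fun q => v q + z q) γ := by
  set A : SpaceTime n → Fin p → ℂ := fun q j => a j q
  have hA : ∀ τ, AnalyticAt ℂ A (γ τ) := fun τ => analyticAt_pi_iff.2 (ha τ)
  let α : C(unitInterval, Fin p → ℂ) := ⟨fun τ => A (γ τ), continuous_iff_continuousAt.2 fun τ =>
    ContinuousAt.comp (g := A) (hA τ).continuousAt γ.continuous.continuousAt⟩
  obtain ⟨ζ, hζ0, hζ⟩ := exists_root_lift α hD (isRootAt_iff.1 hz.2.self_of_nhds)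
  have hζ' : ∀ τ, (Polynomial.derivative (weierstrassPoly (A (γ τ)))).eval (ζ τ) ≠ 0 := fun τ h =>
    hD τ ((weierstrassDisc_eq_zero_iff _).2 ⟨_, hζ τ, h⟩)
  choose f hfan hfγ hfroot hfuniq using fun τ => exists_analyticAt_root (hA τ) (hζ τ) (hζ' τ)
  -- Local uniqueness of a simple root: any continuous root function with the value ζ τ at γ τ is
  -- the chosen germ. This identifies the initial germ and also glues neighbouring germs.
  have key : ∀ τ (g : SpaceTime n → ℂ), ContinuousAt g (γ τ) → g (γ τ) = ζ τ →
      (∀ᶠ q in 𝓝 (γ τ), (weierstrassPoly (A q)).eval (g q) = 0) → g =ᶠ[𝓝 (γ τ)] f τ := by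
    intro τ g hg hgτ hgroot
    have ht : Tendsto (fun q => (q, g q)) (𝓝 (γ τ)) (𝓝 (γ τ, ζ τ)) := by
      rw [← hgτ]
      exact continuousAt_id.prodMk hg
    filter_upwards [ht.eventually (hfuniq τ), hgroot] with q h1 h2
    exact h1 h2
  refine ⟨fun τ q => v q + f τ q, ?_, fun τ => (hv τ).add (hfan τ), fun τ => ?_⟩
  · filter_upwards [key 0 z hz.1.continuousAt hζ0.symm (hz.2.mono fun q h => isRootAt_iff.1 h)]
      with q hq
    rw [hq]
  · have hcont : Tendsto (fun σ => (γ σ, ζ σ)) (𝓝 τ) (𝓝 (γ τ, ζ τ)) :=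
      (γ.continuous.prodMk ζ.continuous).continuousAt
    have hγ : Tendsto γ (𝓝 τ) (𝓝 (γ τ)) := γ.continuous.continuousAt
    filter_upwards [hcont.eventually (hfuniq τ), hγ.eventually (hfroot τ).eventually_nhds,
      hγ.eventually (hfan τ).eventually_analyticAt] with σ h1 h2 h3
    filter_upwards [key σ (f τ) h3.continuousAt (h1 (hζ σ)).symm h2] with q hq
    rw [hq]

end Covering

end RamifiedBurgers

/-! ### Characteristic lines and the implicit equation -/

namespace RamifiedBurgers

variable {n : ℕ}

theorem sum_fderiv_single (h : SpaceTime n → ℂ) (q : SpaceTime n) :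
    ∑ i : Fin n, fderiv ℂ h q (0, Pi.single i 1) = fderiv ℂ h q (0, 1) := by
  rw [← map_sum]
  congr 1
  have h1 := Finset.univ_sum_single (1 : Fin n → ℂ)
  ext i
  · simp [Prod.fst_sum]
  · rw [Prod.snd_sum]
    exact congrFun h1 i

theorem transport_eq (c : ℂ) (h : SpaceTime n → ℂ) (q : SpaceTime n) :
    transport c h q = fderiv ℂ h q (1, 0) - c * fderiv ℂ h q (0, 1) := by
  rw [transport, sum_fderiv_single]

/-- The direction of the characteristic line with speed `c`. -/
def charDir (n : ℕ) (c : ℂ) : SpaceTime n := (1, -(c • 1))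

theorem transport_eq_fderiv_charDir (c : ℂ) (h : SpaceTime n → ℂ) (q : SpaceTime n) :
    transport c h q = fderiv ℂ h q (charDir n c) := by
  have : charDir n c = (1, 0) - c • (0, 1) := by ext <;> simp [charDir]
  rw [transport_eq, this, map_sub, map_smul, smul_eq_mul]

/-- The point where the characteristic line with speed `c` through `q` meets `t = 0`. -/
def foot (q : SpaceTime n) (c : ℂ) : Fin n → ℂ := q.2 + (q.1 * c) • 1

/-- The change -s c in x cancels the change s c in t c. Hence for fixed c the implicit equation does
not vary along the line of speed c. -/
theorem foot_add_smul_charDir (q : SpaceTime n) (c s : ℂ) :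
    foot (q + s • charDir n c) c = foot q c := by
  ext i
  simp [foot, charDir]
  ring

theorem foot_of_fst_eq_zero {q : SpaceTime n} (h : q.1 = 0) (c : ℂ) : foot q c = q.2 := by
  simp [foot, h]

theorem analyticAt_foot (w : SpaceTime n × ℂ) :
    AnalyticAt ℂ (fun w : SpaceTime n × ℂ => foot w.1 w.2) w := by
  unfold foot
  have h1 : AnalyticAt ℂ (fun w : SpaceTime n × ℂ => w.1.1) w :=
    AnalyticAt.fun_comp (g := Prod.fst) analyticAt_fst analyticAt_fst
  have h2 : AnalyticAt ℂ (fun w : SpaceTime n × ℂ => w.1.2) w :=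
    AnalyticAt.fun_comp (g := Prod.snd) analyticAt_snd analyticAt_fst
  exact h2.add ((h1.mul analyticAt_snd).smul analyticAt_const)

/-- A solution of the Burgers equation is constant along its characteristic lines. -/
theorem eventually_eq_apply_foot {w : SpaceTime n → ℂ} {x₀ : Fin n → ℂ}
    (hw : AnalyticAt ℂ w (0, x₀)) (hb : ∀ᶠ q in 𝓝 ((0, x₀) : SpaceTime n), burgers w q = 0) :
    ∀ᶠ q in 𝓝 ((0, x₀) : SpaceTime n), w (0, foot q (w q)) = w q := by
  have hK : ∀ᶠ q in 𝓝 ((0, x₀) : SpaceTime n), ‖fderiv ℂ w q‖ < ‖fderiv ℂ w (0, x₀)‖ + 1 :=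
    hw.fderiv.continuousAt.norm.eventually_lt continuousAt_const (by simp)
  set K := ‖fderiv ℂ w (0, x₀)‖ + 1
  obtain ⟨ε, hε, hball⟩ := Metric.eventually_nhds_iff_ball.1
    (hb.and (hK.and hw.eventually_analyticAt))
  have hend : ∀ᶠ q in 𝓝 ((0, x₀) : SpaceTime n),
      ((0, foot q (w q)) : SpaceTime n) ∈ Metric.ball ((0, x₀) : SpaceTime n) ε := by
    have h1 : ContinuousAt (fun q : SpaceTime n => ((0, foot q (w q)) : SpaceTime n)) (0, x₀) :=
      continuousAt_const.prodMk (ContinuousAt.comp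
        (g := fun w : SpaceTime n × ℂ => foot w.1 w.2) (f := fun q => (q, w q))
        (analyticAt_foot _).continuousAt (continuousAt_id.prodMk hw.continuousAt))
    refine h1.eventually (Metric.isOpen_ball.mem_nhds ?_)
    simp [foot, hε]
  filter_upwards [hend, Metric.ball_mem_nhds _ hε] with q hq1 hq2
  set c := w q with hc
  -- The straight segment from q to its foot, with the speed frozen at c = w q; the ball is convex,
  -- so the segment stays inside.
  let P : ℝ → SpaceTime n := fun τ => q + (τ : ℂ) • (-q.1 • charDir n c)
  have hP1 : P 1 = (0, foot q c) := by
    ext <;> simp [P, charDir, foot]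
  have hPmem : ∀ τ ∈ Set.Icc (0 : ℝ) 1, P τ ∈ Metric.ball ((0, x₀) : SpaceTime n) ε := by
    intro τ hτ
    have h1 := (convex_ball ((0, x₀) : SpaceTime n) ε).add_smul_sub_mem hq2 (hP1 ▸ hq1) hτ
    have h2 : P τ = q + τ • (P 1 - q) := by
      simp only [P, Complex.ofReal_one, one_smul, add_sub_cancel_left]
      rfl
    rwa [h2]
  have hPd : ∀ τ : ℝ, HasDerivAt P (-q.1 • charDir n c) τ := by
    intro τ
    refine ((Complex.ofRealCLM.hasDerivAt (x := τ)).smul_const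
      (-q.1 • charDir n c)).const_add q |>.congr_deriv ?_
    simp
  -- Along speed c the Burgers equation gives w_t - c ∂w = (w - c) ∂w, with ∂ the derivative along
  -- (1, ..., 1). So w - c satisfies a homogeneous linear equation with bounded coefficient and
  -- starts at 0; Grönwall gives w = c.
  have hkd : ∀ τ ∈ Set.Icc (0 : ℝ) 1, HasDerivAt (fun τ => w (P τ) - c)
      (-q.1 * ((w (P τ) - c) * fderiv ℂ w (P τ) (0, 1))) τ := by
    intro τ hτ
    obtain ⟨h1, -, h3⟩ := hball _ (hPmem τ hτ)
    have h4 := (HasFDerivAt.comp_hasDerivAt τ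
      (h3.differentiableAt.hasFDerivAt.restrictScalars ℝ) (hPd τ)).sub_const c
    refine h4.congr_deriv ?_
    rw [ContinuousLinearMap.coe_restrictScalars', map_smul, smul_eq_mul,
      ← transport_eq_fderiv_charDir, transport_eq]
    rw [burgers, transport_eq] at h1
    linear_combination -q.1 * h1
  have hzero := eq_zero_of_abs_deriv_le_mul_abs_self_of_eq_zero_right (K := ‖q.1‖ * K)
    (f := fun τ => w (P τ) - c) (a := 0) (b := 1)
    (fun τ hτ => (hkd τ hτ).continuousAt.continuousWithinAt)
    (fun τ hτ => (hkd τ (Set.Ico_subset_Icc_self hτ)).hasDerivWithinAt) (by simp [P, hc])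
    (fun τ hτ => by
      obtain ⟨-, h2, -⟩ := hball _ (hPmem τ (Set.Ico_subset_Icc_self hτ))
      rw [norm_mul, norm_neg, norm_mul, mul_assoc]
      have h5 : ‖fderiv ℂ w (P τ) (0, 1)‖ ≤ K := by
        refine ((fderiv ℂ w (P τ)).le_opNorm _).trans ?_
        refine (mul_le_of_le_one_right (norm_nonneg _) ?_).trans h2.le
        simp only [Prod.norm_def, norm_zero]
        refine max_le zero_le_one ((pi_norm_le_iff_of_nonneg zero_le_one).2 fun i => by simp)
      rw [mul_comm K]
      gcongr)
    1 (by simp)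
  simp only [hP1] at hzero
  exact sub_eq_zero.1 hzero

variable [NeZero n]

/-- The solution `u` of the Cauchy problem is given by the implicit equation
`implicitEq p u₀ q (u q) = 0`. -/
def implicitEq (p : ℕ) (u₀ : (Fin n → ℂ) → ℂ) (q : SpaceTime n) (c : ℂ) : ℂ :=
  (c - u₀ (foot q c)) ^ p - foot q c 0

variable {p : ℕ} {u₀ : (Fin n → ℂ) → ℂ}

theorem analyticAt_implicitEq {w : SpaceTime n × ℂ} (hu₀ : AnalyticAt ℂ u₀ (foot w.1 w.2)) :
    AnalyticAt ℂ (fun w : SpaceTime n × ℂ => implicitEq p u₀ w.1 w.2) w := by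
  unfold implicitEq
  refine AnalyticAt.sub ((analyticAt_snd.sub ?_).pow p) ?_
  · exact AnalyticAt.fun_comp (g := u₀) hu₀ (analyticAt_foot w)
  · exact analyticAt_pi_iff.1 (analyticAt_foot w) 0

theorem hasDerivAt_implicitEq {q : SpaceTime n} {c : ℂ}
    (hu₀ : DifferentiableAt ℂ u₀ (foot q c)) :
    HasDerivAt (implicitEq p u₀ q)
      (p * (c - u₀ (foot q c)) ^ (p - 1) * (1 - q.1 * fderiv ℂ u₀ (foot q c) 1) - q.1) c := by
  have h1 : HasDerivAt (foot q) (q.1 • 1) c := by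
    refine (((hasDerivAt_id c).const_mul q.1).smul_const (1 : Fin n → ℂ)).const_add q.2
      |>.congr_deriv ?_
    rw [mul_one]
  have h2 : HasDerivAt (fun c => u₀ (foot q c)) (q.1 * fderiv ℂ u₀ (foot q c) 1) c := by
    refine (HasFDerivAt.comp_hasDerivAt c hu₀.hasFDerivAt h1).congr_deriv ?_
    rw [map_smul, smul_eq_mul]
  have h3 : HasDerivAt (fun c => foot q c 0) q.1 c := by
    simpa using hasDerivAt_pi.1 h1 0
  exact (((hasDerivAt_id c).sub h2).pow p).sub h3

/-- A function given by a simple zero of the implicit equation solves the Burgers equation. -/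
theorem burgers_eq_zero_of_implicitEq {u : SpaceTime n → ℂ} {q : SpaceTime n}
    (hu : DifferentiableAt ℂ u q) (hu₀ : AnalyticAt ℂ u₀ (foot q (u q)))
    (hz : ∀ᶠ q' in 𝓝 q, implicitEq p u₀ q' (u q') = 0)
    (hd : deriv (implicitEq p u₀ q) (u q) ≠ 0) : burgers u q = 0 := by
  set c := u q with hc
  rw [burgers, ← hc, transport_eq_fderiv_charDir]
  have hl : HasDerivAt (fun s : ℂ => q + s • charDir n c) (charDir n c) 0 := by
    simpa using ((hasDerivAt_id (0 : ℂ)).smul_const (charDir n c)).const_add q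
  have hl0 : q + (0 : ℂ) • charDir n c = q := by simp
  have hu' : HasDerivAt (fun s : ℂ => u (q + s • charDir n c)) (fderiv ℂ u q (charDir n c)) 0 := by
    refine HasFDerivAt.comp_hasDerivAt (l := u) (0 : ℂ) ?_ hl
    rw [hl0]
    exact hu.hasFDerivAt
  set Φ := fun w : SpaceTime n × ℂ => implicitEq p u₀ w.1 w.2
  have hΦ : HasFDerivAt Φ (fderiv ℂ Φ (q, c)) (q, c) :=
    (analyticAt_implicitEq (w := (q, c)) hu₀).differentiableAt.hasFDerivAt
  -- the implicit equation is constant along the characteristic line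
  have h1 : fderiv ℂ Φ (q, c) (charDir n c, 0) = 0 := by
    have h2 := HasFDerivAt.comp_hasDerivAt (l := Φ) (0 : ℂ) (by rw [hl0]; exact hΦ)
      (hl.prodMk (hasDerivAt_const (0 : ℂ) c))
    have h3 : (fun s : ℂ => Φ (q + s • charDir n c, c)) = fun _ => Φ (q, c) := by
      ext s
      simp only [Φ, implicitEq, foot_add_smul_charDir]
    exact h2.unique (by
      change HasDerivAt (fun s : ℂ => Φ (q + s • charDir n c, c)) 0 0
      rw [h3]
      exact hasDerivAt_const _ _)
  have h4 : fderiv ℂ Φ (q, c) (0, 1) = deriv (implicitEq p u₀ q) c := by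
    have h5 := HasFDerivAt.comp_hasDerivAt (l := Φ) c hΦ
      ((hasDerivAt_const c q).prodMk (hasDerivAt_id c))
    exact h5.deriv.symm
  -- The chain rule for Φ(q, u(q)) = 0 along the line leaves only Φ_c times the derivative of u,
  -- because Φ is constant there at fixed c; and Φ_c ≠ 0.
  have h6 := HasFDerivAt.comp_hasDerivAt (l := Φ) (0 : ℂ) (by rw [hl0]; exact hΦ) (hl.prodMk hu')
  have h7 : HasDerivAt (fun s : ℂ => Φ (q + s • charDir n c, u (q + s • charDir n c))) 0 0 := by
    refine (hasDerivAt_const (0 : ℂ) (0 : ℂ)).congr_of_eventuallyEq ?_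
    have ht : Tendsto (fun s : ℂ => q + s • charDir n c) (𝓝 0) (𝓝 q) := by
      have := hl.continuousAt.tendsto
      rwa [hl0] at this
    exact ht.eventually hz
  have h8 := h6.unique h7
  have h9 : ((charDir n c, fderiv ℂ u q (charDir n c)) : SpaceTime n × ℂ) =
      (charDir n c, 0) + fderiv ℂ u q (charDir n c) • (0, 1) := by ext <;> simp
  rw [h9, map_add, map_smul, h1, h4, zero_add, smul_eq_mul] at h8
  exact (mul_eq_zero.1 h8).resolve_right hd

/-- A solution germ of the Cauchy problem satisfies the implicit equation. -/
theorem eventually_implicitEq_of_isSolutionGerm {r : (Fin n → ℂ) → ℂ} {x₀ : Fin n → ℂ}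
    {w : SpaceTime n → ℂ} (hr : IsRootBranch p r x₀) (hw : IsSolutionGerm u₀ r x₀ w) :
    ∀ᶠ q in 𝓝 ((0, x₀) : SpaceTime n), implicitEq p u₀ q (w q) = 0 := by
  obtain ⟨hw1, hw2, hw3⟩ := hw
  have ht : Tendsto (fun q : SpaceTime n => foot q (w q)) (𝓝 (0, x₀)) (𝓝 x₀) := by
    have h1 : ContinuousAt (fun q : SpaceTime n => foot q (w q)) (0, x₀) := ContinuousAt.comp
        (g := fun w : SpaceTime n × ℂ => foot w.1 w.2) (f := fun q => (q, w q))
        (analyticAt_foot _).continuousAt (continuousAt_id.prodMk hw1.continuousAt)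
    have h2 := h1.tendsto
    rwa [foot_of_fst_eq_zero rfl] at h2
  filter_upwards [eventually_eq_apply_foot hw1 hw2, ht.eventually hw3, ht.eventually hr.2]
    with q h1 h2 h3
  rw [implicitEq, ← h3, sub_eq_zero]
  congr 1
  rw [← sub_eq_iff_eq_add'.2 h2, h1]

end RamifiedBurgers

/-! ### The envelope of double zeros and the reduction to a polynomial -/

namespace RamifiedBurgers

variable {n : ℕ} [NeZero n] {p : ℕ} {u₀ : (Fin n → ℂ) → ℂ}

/-- Double zeros of the implicit equation form a family of curves tangent to the characteristic
directions: through every double zero `(q₀, c₀)` passes a holomorphic curve `(Q, c)` of double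
zeros with `Q' = t' • (1, -c, …, -c)`, along which `c` is injective. -/
theorem exists_curve_of_double_zero {q₀ : SpaceTime n} {c₀ : ℂ}
    (hu₀ : AnalyticAt ℂ u₀ (foot q₀ c₀)) (h0 : implicitEq p u₀ q₀ c₀ = 0)
    (h1 : deriv (implicitEq p u₀ q₀) c₀ = 0) :
    ∃ (Q : ℂ → SpaceTime n) (c t' : ℂ → ℂ), Q 0 = q₀ ∧ c 0 = c₀ ∧ AnalyticAt ℂ t' 0 ∧
      ContinuousAt c 0 ∧ (∀ᶠ s in 𝓝[≠] 0, c s ≠ c₀) ∧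
      (∀ᶠ s in 𝓝 0, HasDerivAt Q (t' s • charDir n (c s)) s) ∧
      ∀ᶠ s in 𝓝 0, implicitEq p u₀ (Q s) (c s) = 0 ∧
        deriv (implicitEq p u₀ (Q s)) (c s) = 0 := by
  set y₀ := foot q₀ c₀ with hy₀
  set w₀ := c₀ - u₀ y₀ with hw₀
  have hw₀p : w₀ ^ p = y₀ 0 := sub_eq_zero.1 h0
  -- The foot moves diagonally so that its first coordinate is (w₀ + s)^p. Thus s uniformizes the
  -- p-th root, and the datum transported from y s is c s.
  let y : ℂ → Fin n → ℂ := fun s => y₀ + ((w₀ + s) ^ p - w₀ ^ p) • 1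
  let A : ℂ → ℂ := fun s => p * (w₀ + s) ^ (p - 1)
  let B : ℂ → ℂ := fun s => fderiv ℂ u₀ (y s) 1
  let c : ℂ → ℂ := fun s => u₀ (y s) + (w₀ + s)
  -- The solution of A (1 - t B) - t = 0, which is the double-zero condition on the line issuing
  -- from y s.
  let t : ℂ → ℂ := fun s => A s / (1 + A s * B s)
  let Q : ℂ → SpaceTime n := fun s => (t s, y s - (t s * c s) • 1)
  have hy0 : y 0 = y₀ := by simp [y]
  have hc0 : c 0 = c₀ := by simp [c, hy0, hw₀]
  have hyan : ∀ s, AnalyticAt ℂ y s := fun s =>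
    analyticAt_const.add ((((analyticAt_const.add analyticAt_id).pow p).sub
      analyticAt_const).smul analyticAt_const)
  have hAan : AnalyticAt ℂ A 0 := analyticAt_const.mul ((analyticAt_const.add analyticAt_id).pow _)
  have hBan : AnalyticAt ℂ B 0 := by
    have h2 : AnalyticAt ℂ (fun s => fderiv ℂ u₀ (y s)) 0 :=
      AnalyticAt.fun_comp (g := fderiv ℂ u₀) (by rw [hy0]; exact hu₀.fderiv) (hyan 0)
    exact AnalyticAt.fun_comp (g := ContinuousLinearMap.apply ℂ ℂ (1 : Fin n → ℂ))
      (ContinuousLinearMap.analyticAt _ _) h2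
  have hyd : ∀ s, HasDerivAt y (A s • 1) s := by
    intro s
    refine ((((hasDerivAt_id s).const_add w₀).pow p |>.sub_const (w₀ ^ p)).smul_const
      (1 : Fin n → ℂ)).const_add y₀ |>.congr_deriv ?_
    simp [A]
  have hu₀ev : ∀ᶠ s in 𝓝 (0 : ℂ), AnalyticAt ℂ u₀ (y s) :=
    (hyan 0).continuousAt.eventually (by rw [hy0]; exact hu₀.eventually_analyticAt)
  have hcd : ∀ᶠ s in 𝓝 (0 : ℂ), HasDerivAt c (A s * B s + 1) s := by
    filter_upwards [hu₀ev] with s hs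
    refine (HasFDerivAt.comp_hasDerivAt s hs.differentiableAt.hasFDerivAt (hyd s)).add
      ((hasDerivAt_id s).const_add w₀) |>.congr_deriv ?_
    rw [map_smul, smul_eq_mul]
  -- the time of the double zero on the characteristic line through `(0, y s)`
  have ht0 : q₀.1 * (1 + A 0 * B 0) = A 0 := by
    have h2 := (hasDerivAt_implicitEq (p := p) (q := q₀) (c := c₀) hu₀.differentiableAt).deriv
    rw [h1, ← hy₀, ← hw₀] at h2
    simp only [A, B, hy0, add_zero]
    linear_combination h2
  -- If the denominator vanished, then A 0 = 0 by `ht0`, and the denominator would be 1.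
  have hne0 : 1 + A 0 * B 0 ≠ 0 := by
    intro h
    rw [h, mul_zero] at ht0
    rw [← ht0, zero_mul, add_zero] at h
    exact one_ne_zero h
  have htan : AnalyticAt ℂ t 0 :=
    hAan.div (analyticAt_const.add (hAan.mul hBan)) hne0
  have hne : ∀ᶠ s in 𝓝 (0 : ℂ), 1 + A s * B s ≠ 0 :=
    (analyticAt_const.add (hAan.mul hBan)).continuousAt.eventually_ne hne0
  have htA : ∀ᶠ s in 𝓝 (0 : ℂ), t s * (1 + A s * B s) = A s :=
    hne.mono fun s hs => div_mul_cancel₀ _ hs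
  have ht0' : t 0 = q₀.1 := (div_eq_iff hne0).2 ht0.symm
  have hfoot : ∀ s, foot (Q s) (c s) = y s := fun s => by simp [foot, Q]
  refine ⟨Q, c, deriv t, ?_, hc0, htan.deriv, hcd.self_of_nhds.continuousAt, ?_, ?_, ?_⟩
  · have : y₀ - (q₀.1 * c₀) • 1 = q₀.2 := by simp [hy₀, foot]
    simp only [Q, ht0', hy0, hc0, this]
  · have := hcd.self_of_nhds.eventually_ne (c := c₀) (by rwa [add_comm])
    exact this
  · filter_upwards [htan.eventually_analyticAt, hcd, htA] with s h2 h3 h4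
    -- In each space component Q' = A - t' c - t c', and t c' = t (1 + A B) = A, so only -t' c
    -- remains: the curve is tangent to the characteristic direction.
    have h5 := h2.differentiableAt.hasDerivAt
    refine h5.prodMk ((hyd s).sub ((h5.mul h3).smul_const 1)) |>.congr_deriv ?_
    ext i
    · simp [charDir]
    · simp [charDir]
      linear_combination -h4
  · filter_upwards [hu₀ev, htA] with s h2 h3
    have h4 : c s - u₀ (y s) = w₀ + s := by simp [c]
    refine ⟨?_, ?_⟩
    · rw [implicitEq, hfoot, h4]
      simp [y, hw₀p]
    · rw [(hasDerivAt_implicitEq (p := p) (q := Q s) (c := c s)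
        (by rw [hfoot]; exact h2.differentiableAt)).deriv, hfoot, h4]
      change A s * (1 - t s * B s) - t s = 0
      linear_combination -h3

/-- A set that contains all nearby double zeros of the implicit equation is characteristic. -/
theorem transport_eq_zero_of_double_zero {q₀ : SpaceTime n} {c₀ : ℂ}
    (hu₀ : AnalyticAt ℂ u₀ (foot q₀ c₀)) (h0 : implicitEq p u₀ q₀ c₀ = 0)
    (h1 : deriv (implicitEq p u₀ q₀) c₀ = 0)
    (hiso : ∀ᶠ c in 𝓝[≠] c₀, implicitEq p u₀ q₀ c ≠ 0) {S : Set (SpaceTime n)}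
    (hS : ∀ᶠ w in 𝓝 (q₀, c₀), implicitEq p u₀ w.1 w.2 = 0 → deriv (implicitEq p u₀ w.1) w.2 = 0 →
      w.1 ∈ S)
    {h : SpaceTime n → ℂ} (hh : AnalyticAt ℂ h q₀) (hhS : ∀ᶠ q in 𝓝 q₀, q ∈ S → h q = 0) :
    transport c₀ h q₀ = 0 := by
  obtain ⟨Q, c, t', hQ0, hc0, htan, hc, hcne, hQd, hzero⟩ := exists_curve_of_double_zero hu₀ h0 h1
  have hQ : ContinuousAt Q 0 := hQd.self_of_nhds.continuousAt
  have hQt : Tendsto Q (𝓝 0) (𝓝 q₀) := by simpa only [hQ0] using hQ.tendsto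
  have hct : Tendsto c (𝓝 0) (𝓝 c₀) := by simpa only [hc0] using hc.tendsto
  have hhQ : ∀ᶠ s in 𝓝 (0 : ℂ), h (Q s) = 0 := by
    have hp : Tendsto (fun s => (Q s, c s)) (𝓝 0) (𝓝 (q₀, c₀)) := hQt.prodMk_nhds hct
    filter_upwards [hp.eventually hS, hQt.eventually hhS, hzero] with s h2 h3 h4
    exact h3 (h2 h4.1 h4.2)
  have hprod : ∀ᶠ s in 𝓝 (0 : ℂ), t' s * transport (c s) h (Q s) = 0 := by
    filter_upwards [hhQ.eventually_nhds, hQd, hQt.eventually hh.eventually_analyticAt]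
      with s h2 h3 h4
    have h5 := HasFDerivAt.comp_hasDerivAt s h4.differentiableAt.hasFDerivAt h3
    have h6 : HasDerivAt (h ∘ Q) 0 s := (hasDerivAt_const s (0 : ℂ)).congr_of_eventuallyEq h2
    have h7 := h5.unique h6
    rwa [map_smul, smul_eq_mul, ← transport_eq_fderiv_charDir] at h7
  -- The factor t' may vanish at s = 0. If it vanishes identically, Q stays at q₀ while c moves,
  -- contradicting isolated zeros; otherwise divide by it for s ≠ 0 and let s tend to 0.
  rcases htan.eventually_eq_zero_or_eventually_ne_zero with hz | hnz
  · exfalso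
    have hconst : ∀ᶠ s in 𝓝 (0 : ℂ), Q s = q₀ := by
      obtain ⟨ε, hε, hb⟩ := Metric.eventually_nhds_iff_ball.1 (hQd.and hz)
      filter_upwards [Metric.ball_mem_nhds (0 : ℂ) hε] with s hs
      rw [← hQ0]
      refine Metric.isOpen_ball.is_const_of_deriv_eq_zero (convex_ball 0 ε).isPreconnected
        (fun s hs => (hb s hs).1.differentiableAt.differentiableWithinAt) (fun s hs => ?_) hs
        (Metric.mem_ball_self hε)
      rw [(hb s hs).1.deriv, (hb s hs).2, zero_smul]
      rfl
    have hcne' : Tendsto c (𝓝[≠] 0) (𝓝[≠] c₀) :=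
      tendsto_nhdsWithin_iff.2 ⟨hct.mono_left nhdsWithin_le_nhds, hcne⟩
    obtain ⟨s, h2, h3, h4⟩ := ((hcne'.eventually hiso).and
      ((hconst.filter_mono nhdsWithin_le_nhds).and
        (hzero.filter_mono nhdsWithin_le_nhds))).exists
    rw [h3] at h4
    exact h2 h4.1
  · have hT : Tendsto (fun s => transport (c s) h (Q s)) (𝓝[≠] 0) (𝓝 (transport c₀ h q₀)) := by
      refine Tendsto.mono_left ?_ nhdsWithin_le_nhds
      simp only [transport_eq]
      have h2 : Tendsto (fun s => fderiv ℂ h (Q s)) (𝓝 0) (𝓝 (fderiv ℂ h q₀)) :=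
        hh.fderiv.continuousAt.tendsto.comp hQt
      have h3 : ∀ d : SpaceTime n,
          Tendsto (fun s => fderiv ℂ h (Q s) d) (𝓝 0) (𝓝 (fderiv ℂ h q₀ d)) := fun d =>
        ((ContinuousLinearMap.apply ℂ ℂ d).continuous.tendsto _).comp h2
      exact (h3 _).sub (hct.mul (h3 _))
    refine tendsto_nhds_unique (hT.congr' ?_) tendsto_const_nhds
    filter_upwards [hnz, hprod.filter_mono nhdsWithin_le_nhds] with s h2 h3
    exact (mul_eq_zero.1 h3).resolve_left h2

/-- Near the origin, the implicit equation for `z = u - u₀` is equivalent to a polynomial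
equation. -/
theorem exists_polynomial_equation [NeZero p] (hu₀ : AnalyticAt ℂ u₀ 0) :
    ∃ (U : Set (SpaceTime n)) (A : SpaceTime n → Fin p → ℂ) (δ : ℝ), IsOpen U ∧ 0 ∈ U ∧
      ∀ q ∈ U, AnalyticAt ℂ A q ∧ AnalyticAt ℂ u₀ q.2 ∧ (q.1 = 0 → A q = Pi.single 0 (q.2 0)) ∧
        (∀ z, (weierstrassPoly (A q)).eval z = 0 → z ∈ Metric.ball (0 : ℂ) δ) ∧
        (∀ z ∈ Metric.ball (0 : ℂ) δ, AnalyticAt ℂ u₀ (foot q (u₀ q.2 + z))) ∧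
        ∃ R : ℂ → ℂ, ∀ z ∈ Metric.ball (0 : ℂ) δ, DifferentiableAt ℂ R z ∧ R z ≠ 0 ∧
          implicitEq p u₀ q (u₀ q.2 + z) = R z * (weierstrassPoly (A q)).eval z := by
  have hv : AnalyticAt ℂ (fun w : SpaceTime n × ℂ => u₀ w.1.2 + w.2) 0 := by
    refine AnalyticAt.add ?_ analyticAt_snd
    exact AnalyticAt.fun_comp (g := u₀) hu₀
      (AnalyticAt.fun_comp (g := Prod.snd) analyticAt_snd analyticAt_fst)
  have hpair : AnalyticAt ℂ (fun w : SpaceTime n × ℂ => (w.1, u₀ w.1.2 + w.2)) 0 :=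
    analyticAt_fst.prod hv
  have hfoot0 : ∀ c, foot (0 : SpaceTime n) c = 0 := fun c => by simp [foot]
  have hF : AnalyticAt ℂ (fun w : SpaceTime n × ℂ => implicitEq p u₀ w.1 (u₀ w.1.2 + w.2)) 0 := by
    refine AnalyticAt.fun_comp (g := fun w : SpaceTime n × ℂ => implicitEq p u₀ w.1 w.2)
      (f := fun w : SpaceTime n × ℂ => (w.1, u₀ w.1.2 + w.2)) (analyticAt_implicitEq ?_) hpair
    change AnalyticAt ℂ u₀ (foot 0 _)
    rwa [hfoot0]
  -- With t = 0 and x = 0 the foot is 0 for every speed, so the equation is exactly z^p, as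
  -- Weierstrass preparation requires.
  have hF0 : ∀ᶠ z in 𝓝 (0 : ℂ), implicitEq p u₀ (0 : SpaceTime n) (u₀ 0 + z) = z ^ p :=
    Eventually.of_forall fun z => by simp [implicitEq, hfoot0]
  obtain ⟨A, hA, hA0, ⟨δ, hδ, hR⟩, huniq⟩ := weierstrass_preparation hF hF0
  have hfootan : ∀ᶠ w in 𝓝 (0 : SpaceTime n × ℂ), AnalyticAt ℂ u₀ (foot w.1 (u₀ w.1.2 + w.2)) := by
    have h1 : ContinuousAt (fun w : SpaceTime n × ℂ => foot w.1 (u₀ w.1.2 + w.2)) 0 :=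
      ContinuousAt.comp (g := fun w : SpaceTime n × ℂ => foot w.1 w.2)
        (f := fun w : SpaceTime n × ℂ => (w.1, u₀ w.1.2 + w.2))
        (analyticAt_foot _).continuousAt hpair.continuousAt
    refine h1.eventually ?_
    change ∀ᶠ y in 𝓝 (foot 0 _), AnalyticAt ℂ u₀ y
    rw [hfoot0]
    exact hu₀.eventually_analyticAt
  obtain ⟨P, hP, P', hP', hPP⟩ := eventually_prod_iff.1
    (show ∀ᶠ w in 𝓝 (0 : SpaceTime n) ×ˢ 𝓝 (0 : ℂ),
      AnalyticAt ℂ u₀ (foot w.1 (u₀ w.1.2 + w.2)) by rw [← nhds_prod_eq]; exact hfootan)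
  obtain ⟨δ', hδ', hball⟩ := Metric.eventually_nhds_iff_ball.1 hP'
  -- At t = 0 the equation is the monic polynomial z^p - x₁ itself, so uniqueness in Weierstrass
  -- preparation determines the coefficients.
  have hinit : ∀ᶠ q in 𝓝 (0 : SpaceTime n), q.1 = 0 → A q = Pi.single 0 (q.2 0) := by
    have hc : Tendsto (fun q : SpaceTime n => (q, (Pi.single 0 (q.2 0) : Fin p → ℂ))) (𝓝 0)
        (𝓝 0) := by
      have : Continuous fun q : SpaceTime n => (q, (Pi.single 0 (q.2 0) : Fin p → ℂ)) :=
        continuous_id.prodMk ((continuous_single (A := fun _ : Fin p => ℂ) 0).comp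
          ((continuous_apply 0).comp continuous_snd))
      have h2 := this.tendsto 0
      have h3 : ((0 : SpaceTime n), (Pi.single 0 ((0 : SpaceTime n).2 0) : Fin p → ℂ)) = 0 := by
        simp
      rwa [h3] at h2
    filter_upwards [hc.eventually huniq] with q hq h0
    refine (hq fun z => ?_).symm
    simp only [implicitEq, foot_of_fst_eq_zero h0, eval_weierstrassPoly]
    rw [Finset.sum_eq_single 0 (fun j _ hj => by simp [Pi.single_eq_of_ne hj]) (by simp)]
    simp
  have hroots : ∀ᶠ q in 𝓝 (0 : SpaceTime n), ∀ z, (weierstrassPoly (A q)).eval z = 0 →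
      ‖z‖ < min δ δ' := by
    have h1 := hA.continuousAt.tendsto
    rw [hA0] at h1
    exact h1.eventually (eventually_norm_root_lt (lt_min hδ hδ'))
  have hu₀ev : ∀ᶠ q in 𝓝 (0 : SpaceTime n), AnalyticAt ℂ u₀ q.2 :=
    (continuousAt_snd (p := (0 : SpaceTime n))).eventually hu₀.eventually_analyticAt
  obtain ⟨U, hU, hUo, h0U⟩ := eventually_nhds_iff.1 (hA.eventually_analyticAt.and
    (hu₀ev.and (hinit.and (hroots.and (hP.and hR)))))
  refine ⟨U, A, min δ δ', hUo, h0U, fun q hq => ?_⟩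
  obtain ⟨h1, h2, h3, h4, h5, R, h6⟩ := hU q hq
  refine ⟨h1, h2, h3, fun z hz => mem_ball_zero_iff.2 (h4 z hz), fun z hz => ?_, R, fun z hz => ?_⟩
  · exact hPP h5 (hball z (Metric.ball_subset_ball (min_le_right _ _) hz))
  · exact h6 z (Metric.ball_subset_ball (min_le_left _ _) hz)

end RamifiedBurgers

/-! ### Transfer of zeros to the polynomial, and the main theorem -/

namespace RamifiedBurgers

/-- Double zeros are preserved by division by a nonvanishing function. -/
theorem mul_zero_and_deriv_zero_iff {f R g : ℂ → ℂ} {z : ℂ} (hfRg : f =ᶠ[𝓝 z] fun y => R y * g y)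
    (hR : DifferentiableAt ℂ R z) (hg : DifferentiableAt ℂ g z) (hR0 : R z ≠ 0) :
    (f z = 0 ↔ g z = 0) ∧ (g z = 0 → (deriv f z = 0 ↔ deriv g z = 0)) := by
  refine ⟨by simp [hfRg.self_of_nhds, hR0], fun h => ?_⟩
  rw [hfRg.deriv_eq, (hR.hasDerivAt.fun_mul hg.hasDerivAt).deriv]
  simp [h, hR0]

variable {n p : ℕ} [NeZero n] {u₀ : (Fin n → ℂ) → ℂ}

/-- Simple and double zeros of the implicit equation are those of the polynomial equation. -/
theorem implicitEq_eq_zero_iff {q : SpaceTime n} {b : Fin p → ℂ} {δ : ℝ} {R : ℂ → ℂ}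
    (hR : ∀ z ∈ Metric.ball (0 : ℂ) δ, DifferentiableAt ℂ R z ∧ R z ≠ 0 ∧
      implicitEq p u₀ q (u₀ q.2 + z) = R z * (weierstrassPoly b).eval z)
    {c : ℂ} (hc : c - u₀ q.2 ∈ Metric.ball (0 : ℂ) δ) :
    (implicitEq p u₀ q c = 0 ↔ (weierstrassPoly b).eval (c - u₀ q.2) = 0) ∧
      ((weierstrassPoly b).eval (c - u₀ q.2) = 0 → (deriv (implicitEq p u₀ q) c = 0 ↔
        (Polynomial.derivative (weierstrassPoly b)).eval (c - u₀ q.2) = 0)) := by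
  have hev : (fun y => implicitEq p u₀ q (u₀ q.2 + y)) =ᶠ[𝓝 (c - u₀ q.2)]
      fun y => R y * (weierstrassPoly b).eval y := by
    filter_upwards [Metric.isOpen_ball.mem_nhds hc] with y hy
    exact (hR y hy).2.2
  have h := mul_zero_and_deriv_zero_iff hev (hR _ hc).1 (weierstrassPoly b).differentiableAt
    (hR _ hc).2.1
  rw [Polynomial.deriv, deriv_comp_const_add] at h
  simpa using h

end RamifiedBurgers

open RamifiedBurgers

theorem mainTheorem2 (n p : ℕ) [NeZero n] [NeZero p]
    (u₀ : (Fin n → ℂ) → ℂ) (hu₀ : AnalyticAt ℂ u₀ 0) :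
    ∃ (U : Set (RamifiedBurgers.SpaceTime n)) (v : RamifiedBurgers.SpaceTime n → ℂ)
      (a : Fin p → RamifiedBurgers.SpaceTime n → ℂ) (D : RamifiedBurgers.SpaceTime n → ℂ),
      -- holomorphic data near the origin
      IsOpen U ∧ (0 : RamifiedBurgers.SpaceTime n) ∈ U ∧
      AnalyticOnNhd ℂ v U ∧ (∀ j, AnalyticOnNhd ℂ (a j) U) ∧ AnalyticOnNhd ℂ D U ∧
      -- initial conditions
      (∀ x, ((0, x) : RamifiedBurgers.SpaceTime n) ∈ U →
        v (0, x) = u₀ x ∧ a 0 (0, x) = x 0 ∧ ∀ j, j ≠ 0 → a j (0, x) = 0) ∧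
      -- the branch locus `D = 0`: a characteristic hypersurface that restricts to `x₁ = 0`
      (∀ q ∈ U, D q = 0 ↔ ∃ ζ, RamifiedBurgers.IsMultipleRootAt a q ζ) ∧
      (∀ x, ((0, x) : RamifiedBurgers.SpaceTime n) ∈ U → (D (0, x) = 0 ↔ p ≠ 1 ∧ x 0 = 0)) ∧
      RamifiedBurgers.IsCharacteristic v a {q ∈ U | D q = 0} ∧
      -- every branch of `v + z` off the branch locus solves the equation
      (∀ q ∈ U, D q ≠ 0 → ∀ z, RamifiedBurgers.IsAlgebraicGerm a q z →
        RamifiedBurgers.burgers (fun q' => v q' + z q') q = 0) ∧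
      -- for every choice of base point and of branch of the datum, the initial value problem has
      -- a solution `v + z`; it is unique, and continues along all paths off the branch locus
      (∀ x₀, ((0, x₀) : RamifiedBurgers.SpaceTime n) ∈ U → D (0, x₀) ≠ 0 →
        ∀ r, RamifiedBurgers.IsRootBranch p r x₀ →
          ∃ z, RamifiedBurgers.IsAlgebraicGerm a (0, x₀) z ∧
            (∀ᶠ x in nhds x₀, z (0, x) = r x) ∧
            RamifiedBurgers.IsSolutionGerm u₀ r x₀ (fun q => v q + z q) ∧
            (∀ w, RamifiedBurgers.IsSolutionGerm u₀ r x₀ w →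
              w =ᶠ[nhds (0, x₀)] fun q => v q + z q) ∧
            ∀ γ : C(unitInterval, RamifiedBurgers.SpaceTime n), γ 0 = (0, x₀) →
              (∀ τ, γ τ ∈ U ∧ D (γ τ) ≠ 0) →
              RamifiedBurgers.ContinuesAlong (fun q => v q + z q) γ) := by
  obtain ⟨U, A, δ, hUo, h0U, hU⟩ := exists_polynomial_equation (p := p) hu₀
  choose! hA hv hinit hroot hfoot R hR using hU
  have hD : ∀ q ∈ U, AnalyticAt ℂ (fun q => weierstrassDisc (A q)) q := fun q hq =>
    AnalyticAt.fun_comp (analyticAt_weierstrassDisc _) (hA q hq)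
  have hvan : ∀ q ∈ U, AnalyticAt ℂ (fun q : SpaceTime n => u₀ q.2) q := fun q hq =>
    AnalyticAt.fun_comp (hv q hq) analyticAt_snd
  have hW0 : ∀ x z, ((0, x) : SpaceTime n) ∈ U →
      (weierstrassPoly (A (0, x))).eval z = z ^ p - x 0 := by
    intro x z hx
    rw [hinit _ hx rfl, eval_weierstrassPoly,
      Finset.sum_eq_single 0 (fun j _ hj => by simp [Pi.single_eq_of_ne hj]) (by simp)]
    simp
  have hburgers : ∀ q ∈ U, weierstrassDisc (A q) ≠ 0 → ∀ z,
      IsAlgebraicGerm (fun j q => A q j) q z → burgers (fun q' => u₀ q'.2 + z q') q = 0 := by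
    intro q hq hDq z hz
    have hz0 := isRootAt_iff.1 hz.2.self_of_nhds
    have hd := (implicitEq_eq_zero_iff (hR q hq) (c := u₀ q.2 + z q)
      (by rw [add_sub_cancel_left]; exact hroot q hq _ hz0))
    rw [add_sub_cancel_left] at hd
    refine burgers_eq_zero_of_implicitEq (p := p) (u₀ := u₀)
      ((hvan q hq).add hz.1).differentiableAt (hfoot q hq _ (hroot q hq _ hz0)) ?_ fun h => ?_
    · filter_upwards [hz.2, hUo.mem_nhds hq] with q' h1 h2
      have h1' := isRootAt_iff.1 h1
      refine (implicitEq_eq_zero_iff (hR q' h2) ?_).1.2 ?_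
      · rw [add_sub_cancel_left]
        exact hroot q' h2 _ h1'
      · rwa [add_sub_cancel_left]
    · exact hDq ((weierstrassDisc_eq_zero_iff _).2 ⟨_, hz0, (hd.2 hz0).1 h⟩)
  refine ⟨U, fun q => u₀ q.2, fun j q => A q j, fun q => weierstrassDisc (A q), hUo, h0U, hvan,
    fun j q hq => analyticAt_pi_iff.1 (hA q hq) j, hD, fun x hx => ⟨rfl, ?_, fun j hj => ?_⟩,
    fun q hq => ?_, fun x hx => ?_, ?_, hburgers, fun x₀ hx₀ hDx₀ r hr => ?_⟩
  · simp [hinit _ hx rfl]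
  · simp [hinit _ hx rfl, hj]
  · exact (weierstrassDisc_eq_zero_iff (A q)).trans (exists_congr fun ζ =>
      (isMultipleRootAt_iff (a := fun j q => A q j) (q := q) (ζ := ζ)).symm)
  · have hW' : ∀ z, (Polynomial.derivative (weierstrassPoly (A (0, x)))).eval z =
        p * z ^ (p - 1) := by
      intro z
      rw [hinit _ hx rfl, eval_derivative_weierstrassPoly,
        Finset.sum_eq_single 0 (fun j _ hj => by simp [Pi.single_eq_of_ne hj]) (by simp)]
      simp
    have hp : (p : ℂ) ≠ 0 := NeZero.ne _
    simp only [weierstrassDisc_eq_zero_iff, hW0 x _ hx, hW', sub_eq_zero]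
    constructor
    · rintro ⟨z, h1, h2⟩
      -- The condition z^(p-1) = 0 is impossible for p = 1, where it reads 1 = 0; this is the source
      -- of p ≠ 1.
      have h3 := (mul_eq_zero.1 h2).resolve_left hp
      have hp1 : p ≠ 1 := by
        rintro rfl
        simp at h3
      have hz : z = 0 := eq_zero_of_pow_eq_zero h3
      exact ⟨hp1, by rw [← h1, hz, zero_pow (NeZero.ne p)]⟩
    · rintro ⟨h1, h2⟩
      have := NeZero.pos p
      exact ⟨0, by rw [h2, zero_pow (NeZero.ne p)], by rw [zero_pow (by omega), mul_zero]⟩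
  · rintro q ⟨hq, -⟩ ζ hζ h hh hhS
    obtain ⟨hζ0, hζ1⟩ := (isMultipleRootAt_iff (a := fun j q => A q j) (q := q) (ζ := ζ)).1 hζ
    have hζδ := hroot q hq ζ hζ0
    have hdict := implicitEq_eq_zero_iff (hR q hq) (c := u₀ q.2 + ζ)
      (by rwa [add_sub_cancel_left])
    rw [add_sub_cancel_left] at hdict
    have hsub : ContinuousAt (fun w : SpaceTime n × ℂ => w.2 - u₀ w.1.2) (q, u₀ q.2 + ζ) :=
      continuousAt_snd.sub (ContinuousAt.comp (g := fun q : SpaceTime n => u₀ q.2)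
        (hvan q hq).continuousAt continuousAt_fst)
    have hnear : ∀ᶠ w in 𝓝 (q, u₀ q.2 + ζ), w.2 - u₀ w.1.2 ∈ Metric.ball (0 : ℂ) δ :=
      hsub.eventually (Metric.isOpen_ball.mem_nhds (by simpa using hζδ))
    refine transport_eq_zero_of_double_zero (p := p) (u₀ := u₀) (hfoot q hq ζ hζδ)
      (hdict.1.2 hζ0) ((hdict.2 hζ0).2 hζ1) ?_ ?_ hh hhS
    -- Near this speed the zeros of the implicit equation correspond to roots of a nonzero
    -- polynomial; there are finitely many, hence they are isolated.
    · have hfin : {c | (weierstrassPoly (A q)).eval (c - u₀ q.2) = 0}.Finite := by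
        refine ((weierstrassPoly (A q)).roots.toFinset.finite_toSet.image
          fun z => u₀ q.2 + z).subset fun c hc => ⟨c - u₀ q.2, ?_, by simp⟩
        simpa [(monic_weierstrassPoly _).ne_zero] using hc
      have h1 : ∀ᶠ c in 𝓝[≠] (u₀ q.2 + ζ), (weierstrassPoly (A q)).eval (c - u₀ q.2) ≠ 0 := by
        rw [eventually_nhdsWithin_iff]
        filter_upwards [(hfin.subset (Set.sdiff_subset
          (t := {u₀ q.2 + ζ}))).isClosed.isOpen_compl.mem_nhds (by simp)] with c hc hne h0
        exact hc ⟨h0, hne⟩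
      have h2 : ∀ᶠ c in 𝓝 (u₀ q.2 + ζ), c - u₀ q.2 ∈ Metric.ball (0 : ℂ) δ :=
        (continuousAt_id.sub continuousAt_const).eventually
          (Metric.isOpen_ball.mem_nhds (by simpa using hζδ))
      filter_upwards [h1, h2.filter_mono nhdsWithin_le_nhds] with c h3 h4 h5
      exact h3 ((implicitEq_eq_zero_iff (hR q hq) h4).1.1 h5)
    · filter_upwards [hnear, continuousAt_fst.eventually (hUo.mem_nhds hq)] with w h1 h2 h3 h4
      have h5 := implicitEq_eq_zero_iff (hR _ h2) h1
      have h6 := h5.1.1 h3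
      exact ⟨h2, (weierstrassDisc_eq_zero_iff _).2 ⟨_, h6, (h5.2 h6).1 h4⟩⟩
  · have hr0 : (weierstrassPoly (A (0, x₀))).eval (r x₀) = 0 := by
      rw [hW0 _ _ hx₀, hr.2.self_of_nhds, sub_self]
    obtain ⟨z, hzan, hz0, hzroot, hzuniq⟩ := exists_analyticAt_root (hA _ hx₀) hr0 fun h =>
      hDx₀ ((weierstrassDisc_eq_zero_iff _).2 ⟨_, hr0, h⟩)
    have hzalg : IsAlgebraicGerm (fun j q => A q j) (0, x₀) z :=
      ⟨hzan, hzroot.mono fun q hq => isRootAt_iff.2 hq⟩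
    have hslice : Tendsto (fun x => ((0, x) : SpaceTime n)) (𝓝 x₀) (𝓝 (0, x₀)) :=
      (Continuous.prodMk_right 0).tendsto x₀
    have hzr : ∀ᶠ x in 𝓝 x₀, z (0, x) = r x := by
      have ht : Tendsto (fun x => (((0, x) : SpaceTime n), r x)) (𝓝 x₀) (𝓝 ((0, x₀), r x₀)) :=
        hslice.prodMk_nhds hr.1.continuousAt
      -- On the slice t = 0 the branch r is also a continuous root with the same value at x₀, so it
      -- agrees with z.
      filter_upwards [ht.eventually hzuniq, hr.2, hslice.eventually (hUo.mem_nhds hx₀)]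
        with x h1 h2 h3
      exact (h1 (by rw [hW0 _ _ h3, h2, sub_self])).symm
    refine ⟨z, hzalg, hzr, ⟨(hvan _ hx₀).add hzan, ?_, ?_⟩, fun w hw => ?_, fun γ hγ hγU => ?_⟩
    · filter_upwards [hUo.mem_nhds hx₀, (hD _ hx₀).continuousAt.eventually_ne hDx₀,
        hzan.eventually_analyticAt, hzalg.2.eventually_nhds] with q h1 h2 h3 h4
      exact hburgers q h1 h2 z ⟨h3, h4⟩
    · filter_upwards [hzr] with x hx
      rw [hx]
    -- For any solution germ w, the function w - v is a root of the polynomial by the implicit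
    -- equation, with value r x₀ at the base point; local uniqueness of the simple root gives w = v
    -- + z.
    · have hw0 : w (0, x₀) - u₀ x₀ = r x₀ := by
        rw [hw.2.2.self_of_nhds, add_sub_cancel_left]
      have hc : ContinuousAt (fun q : SpaceTime n => w q - u₀ q.2) (0, x₀) :=
        hw.1.continuousAt.sub (hvan _ hx₀).continuousAt
      have ht : Tendsto (fun q : SpaceTime n => (q, w q - u₀ q.2)) (𝓝 (0, x₀))
          (𝓝 ((0, x₀), r x₀)) := by
        rw [← hw0]
        exact tendsto_id.prodMk_nhds hc
      have hnear : ∀ᶠ q in 𝓝 ((0, x₀) : SpaceTime n), w q - u₀ q.2 ∈ Metric.ball (0 : ℂ) δ :=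
        hc.eventually (Metric.isOpen_ball.mem_nhds (by
          simp only [hw0]
          exact hroot _ hx₀ _ hr0))
      filter_upwards [eventually_implicitEq_of_isSolutionGerm hr hw, hUo.mem_nhds hx₀, hnear,
        ht.eventually hzuniq] with q h1 h2 h3 h4
      rw [← h4 ((implicitEq_eq_zero_iff (hR q h2) h3).1.1 h1)]
      ring
    · rw [← hγ] at hzalg
      exact continuesAlong_add_root (fun τ => hvan _ (hγU τ).1)
        (fun τ j => analyticAt_pi_iff.1 (hA _ (hγU τ).1) j) (fun τ => (hγU τ).2) hzalg
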